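/- Let $\beta\in(0,1)$ and let $f_0:[0,1]\to\mathbb R$ be a profile such that $f_0(r)=\tilde f_0(r^2)$ with $\tilde f_0\in C^{2,\beta}([0,1])$, and $\inf_{r\in(0,1]}f_0'(r)/r>0$. Set $$\kappa_2=\int_0^1 sf_0(s)\,ds,\qquad \widehat\Omega_n=\kappa_2-\frac{n+1}{n}\int_0^1 s^{2n+1}f_0(s)\,ds\quad(n\ge1),$$ $$\mu^0_\Omega(r)=\frac{f_0'(r)}{r\left(\Omega-\int_0^1 sf_0(sr)\,ds\right)},\qquad \nu_\Omega=|\mu_\Omega^0| ,$$ and let $F_{n,\Omega}$ be the unique $C^2$ solution on $[0,1]$ of $$F''+\tfrac{2n+1}{r}F'+\mu^0_\Omega F=0,\qquad F(0)=1.$$ Define the dispersion function $$\zeta_n(\Omega)=F_{n,\Omega}(1)\Big(\Omega-\tfrac{n}{n+1}\kappa_2\Big)+\int_0^1F_{n,\Omega}(s)s^{2n+1}\big(f_0(s)-2\Omega\big)ds,$$ and, for $m\ge1$ and $\Omega$ given, with $H_m[h](1)=\int_0^1 s^{m+1}h(s)\,ds$, $$G_m(r)=m\Omega r^{m+1}+r^{m-1}\kappa_2-(m+1)r^{m-1}\int_0^r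 sf_0(s)ds+\frac{m+1}{r^{m+1}}\int_0^r s^{2m+1}f_0(s)ds,$$ $$A_m[h]=-\frac{H_m[h](1)}{2G_m(1)},$$ $$h_m^\star(r)=r^mF_{m,\Omega}(r)\mu^0_{\Omega}(r)\int_1^r\frac{1}{F_{m,\Omega}^2(s)s^{2m+1}}\int_0^sF_{m,\Omega}(\tau)\tau^{2m+1}\Big(\Omega-\tfrac{f_0(\tau)}2\Big)d\tau\,ds,$$ $$d_m^\star(r)=h_m^\star(r)\frac{r}{f_0'(r)}+\frac{A_m[h_m^\star]}{G_m(1)}\,rG_m(r)-A_m[h_m^\star]\,r^{m+2},$$ $$\mathbb I_m=\mathbb I_m(\Omega)=\int_0^1\nu_{\Omega}(r)\,r^{m+1}F_{m,\Omega}(r)\,d_m^\star(r)\,dr .$$ (i) Assume $f_0>0$ on $[0,1]$. Let $m$ be an integer with $3\le m\le\frac1{10}\frac{f_0(0)}{f_0(1)-f_0(0)}$ and let $\Omega_m\in\big(\widehat\Omega_m,\frac{m\kappa_2}{m+1}\big)$ satisfy $\zeta_m(\Omega_m)=0$. Then $\mathbb I_m(\Omega_m)\ne0$. (ii) Assume $f_0<0$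 on $[0,1]$ and let $a\in(1,2)$. There is $m_0\ge1$ such that for every integer $m\ge m_0$ and every $\Omega_m\in(\widehat\Omega_m-m^{-a},\widehat\Omega_m)$ with $\zeta_m(\Omega_m)=0$ one has $\mathbb I_m(\Omega_m)\neq0$. Moreover $4(m+1)|\mathbb I_m(\Omega_m)|\to\infty$ as $m\to\infty$, uniformly over all such $\Omega_m$: for every $K\in\mathbb R$ there is $m_0\ge1$ such that $4(m+1)|\mathbb I_m(\Omega_m)|\ge K$ for all $m\ge m_0$ and all such $\Omega_m$. -/

import Mathlib

/-!
At a zero of `ζ_m` one has `r^{-m} d_m^⋆(r) = R(r) / g(r) + N(r) / (4 (m + 1) G_m(1))`. Here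
`g(r) = Ω - ∫₀¹ s f₀(sr) ds` is the denominator of `μ_Ω⁰`, `R` solves the radial equation with
right-hand side `Ω - f₀/2` and `R(1) = 0`, and `N` vanishes at `r = 1` and depends only on `f₀` and
`m`. Since `G_m(1) = m (Ω - Ω̂_m)` is small, the second term dominates.

If `f₀ > 0`, then `g < 0`, hence `F_{m,Ω} ≥ 1`. Flatness of `f₀` relative to `1/m` gives both
`|R/g| ≤ 3 (1 - r²) / (8 (m + 1))` and `N / G_m(1) > 3/2 (1 - r²)`, so the integrand is positive.

If `f₀ < 0`, then `g` is comparable to `1/m + 1 - r²`, hence `F_{m,Ω} = 1 + O(log m / m)`. The first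
term contributes `O(1)` to `4 (m + 1) 𝕀_m`. The second contributes `∫ ν r^{2m+1} F N`, which is
bounded below by a positive constant, divided by `G_m(1) ∈ (-m^{1-a}, 0)`; so `4 (m + 1) 𝕀_m` tends
to `-∞` at least as fast as `-m^{a-1}`.
-/

open Set

namespace RadialEuler

noncomputable section

/-- `f₀(r) = f̃₀(r²)` on `[0,1]` with `f̃₀` of class `C^{2,β}` on `[0,1]`. -/
def SmoothProfile (β : ℝ) (f₀ : ℝ → ℝ) : Prop :=
  ∃ g : ℝ → ℝ, (∀ r ∈ Icc (0 : ℝ) 1, f₀ r = g (r ^ 2)) ∧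
    ContDiffOn ℝ 2 g (Icc 0 1) ∧
    ∃ C : ℝ, ∀ x ∈ Icc (0 : ℝ) 1, ∀ y ∈ Icc (0 : ℝ) 1,
      |derivWithin (derivWithin g (Icc 0 1)) (Icc 0 1) x
        - derivWithin (derivWithin g (Icc 0 1)) (Icc 0 1) y| ≤ C * |x - y| ^ β

/-- The derivative `f₀'` on `[0,1]` (one-sided at the end points). -/
def profileDeriv (f₀ : ℝ → ℝ) (r : ℝ) : ℝ := derivWithin f₀ (Icc 0 1) r

/-- `inf_{r ∈ (0,1]} f₀'(r) / r > 0`. -/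
def MonotoneProfile (f₀ : ℝ → ℝ) : Prop :=
  ∃ c : ℝ, 0 < c ∧ ∀ r ∈ Ioc (0 : ℝ) 1, c ≤ profileDeriv f₀ r / r

/-- `κ₂ = ∫₀¹ s f₀(s) ds`. -/
def kappa₂ (f₀ : ℝ → ℝ) : ℝ := ∫ s in (0 : ℝ)..1, s * f₀ s

/-- The singular values
`Ω̂ₙ = ∫₀¹ s f₀(s) ds - (n+1)/n ∫₀¹ s^{2n+1} f₀(s) ds`, for `n ≥ 1`. -/
def singularValue (f₀ : ℝ → ℝ) (n : ℕ) : ℝ :=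
  kappa₂ f₀ - ((n : ℝ) + 1) / n * ∫ s in (0 : ℝ)..1, s ^ (2 * n + 1) * f₀ s

/-- `μ_Ω⁰(r) = f₀'(r) / (r (Ω - ∫₀¹ s f₀(s r) ds))`, for `r ∈ (0,1]`. -/
def mu (f₀ : ℝ → ℝ) (Ω r : ℝ) : ℝ :=
  profileDeriv f₀ r / (r * (Ω - ∫ s in (0 : ℝ)..1, s * f₀ (s * r)))

/-- `ν_Ω = |μ_Ω⁰|`. -/
def nu (f₀ : ℝ → ℝ) (Ω r : ℝ) : ℝ := |mu f₀ Ω r|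

/-- `F` is of class `C²` on `[0,1]`, `F(0) = 1`, and
`F'' + (2n+1)/r F' + μ_Ω⁰ F = 0` for `0 < r ≤ 1`. -/
def IsSturmSolution (f₀ : ℝ → ℝ) (n : ℕ) (Ω : ℝ) (F : ℝ → ℝ) : Prop :=
  ContDiffOn ℝ 2 F (Icc 0 1) ∧ F 0 = 1 ∧
    ∀ r ∈ Ioc (0 : ℝ) 1,
      derivWithin (derivWithin F (Icc 0 1)) (Icc 0 1) r
        + (2 * (n : ℝ) + 1) / r * derivWithin F (Icc 0 1) r
        + mu f₀ Ω r * F r = 0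

open Classical in
/-- `F_{n,Ω}`: the `C²` solution on `[0,1]` of the normalized Sturm-Liouville equation. Only its
values on `[0,1]`, where it is unique, are used. -/
def sturm (f₀ : ℝ → ℝ) (n : ℕ) (Ω : ℝ) : ℝ → ℝ :=
  if h : ∃ F : ℝ → ℝ, IsSturmSolution f₀ n Ω F then h.choose else 0

/-- The dispersion function
`ζₙ(Ω) = F_{n,Ω}(1) (Ω - n/(n+1) ∫₀¹ s f₀(s) ds) + ∫₀¹ F_{n,Ω}(s) s^{2n+1} (f₀(s) - 2Ω) ds`. -/
def zeta (f₀ : ℝ → ℝ) (n : ℕ) (Ω : ℝ) : ℝ :=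
  sturm f₀ n Ω 1 * (Ω - (n : ℝ) / (n + 1) * kappa₂ f₀)
    + ∫ s in (0 : ℝ)..1, sturm f₀ n Ω s * s ^ (2 * n + 1) * (f₀ s - 2 * Ω)

/-- `Hₙ[h](r) = r^{2n} ∫_r^1 s^{1-n} h(s) ds + ∫_0^r s^{n+1} h(s) ds`. -/
def Hop (n : ℕ) (h : ℝ → ℝ) (r : ℝ) : ℝ :=
  r ^ (2 * n) * (∫ s in r..1, s ^ (1 - (n : ℤ)) * h s) + ∫ s in (0 : ℝ)..r, s ^ (n + 1) * h s

/-- `Gₙ(r) = nΩ r^{n+1} + r^{n-1} ∫₀¹ s f₀ - (n+1) r^{n-1} ∫_0^r s f₀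
+ (n+1)/r^{n+1} ∫_0^r s^{2n+1} f₀`, for `n ≥ 1`. -/
def Gfun (f₀ : ℝ → ℝ) (n : ℕ) (Ω r : ℝ) : ℝ :=
  n * Ω * r ^ (n + 1) + r ^ (n - 1) * kappa₂ f₀
    - (n + 1) * r ^ (n - 1) * (∫ s in (0 : ℝ)..r, s * f₀ s)
    + (n + 1) / r ^ (n + 1) * ∫ s in (0 : ℝ)..r, s ^ (2 * n + 1) * f₀ s

/-- `Aₙ[h] = - Hₙ[h](1) / (2 Gₙ(1))`. -/
def Aop (f₀ : ℝ → ℝ) (n : ℕ) (Ω : ℝ) (h : ℝ → ℝ) : ℝ :=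
  -(Hop n h 1 / (2 * Gfun f₀ n Ω 1))

/-- The radial part `h_m^⋆` of the generator of the kernel. -/
def hStar (f₀ : ℝ → ℝ) (m : ℕ) (Ω r : ℝ) : ℝ :=
  r ^ m * sturm f₀ m Ω r * mu f₀ Ω r *
    ∫ s in (1 : ℝ)..r, 1 / (sturm f₀ m Ω s ^ 2 * s ^ (2 * m + 1)) *
      ∫ τ in (0 : ℝ)..s, sturm f₀ m Ω τ * τ ^ (2 * m + 1) * (Ω - f₀ τ / 2)

/-- `d_m^⋆(r) = h_m^⋆(r) r / f₀'(r) + A_m[h_m^⋆]/G_m(1) r G_m(r) - A_m[h_m^⋆] r^{m+2}`. -/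
def dStar (f₀ : ℝ → ℝ) (m : ℕ) (Ω r : ℝ) : ℝ :=
  hStar f₀ m Ω r * (r / profileDeriv f₀ r)
    + Aop f₀ m Ω (hStar f₀ m Ω) / Gfun f₀ m Ω 1 * r * Gfun f₀ m Ω r
    - Aop f₀ m Ω (hStar f₀ m Ω) * r ^ (m + 2)

/-- The transversality integral `𝕀_m = ∫₀¹ ν_Ω(r) r^{m+1} F_{m,Ω}(r) d_m^⋆(r) dr`. -/
def transInt (f₀ : ℝ → ℝ) (m : ℕ) (Ω : ℝ) : ℝ :=
  ∫ r in (0 : ℝ)..1, nu f₀ Ω r * r ^ (m + 1) * sturm f₀ m Ω r * dStar f₀ m Ω r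

end

end RadialEuler

namespace RadialEuler

noncomputable section

open MeasureTheory

section Calculus

variable {q u v u' v' : ℝ → ℝ} {a b x y r : ℝ}

lemma intervalIntegrable_of_continuousOn (hq : ContinuousOn q (Icc a b)) (hx : x ∈ Icc a b)
    (hy : y ∈ Icc a b) : IntervalIntegrable q volume x y :=
  (hq.mono (uIcc_subset_Icc hx hy)).intervalIntegrable

lemma continuousOn_primitive (hq : ContinuousOn q (Icc a b)) (hx : x ∈ Icc a b) :
    ContinuousOn (fun r => ∫ s in x..r, q s) (Icc a b) := by
  have hab : a ≤ b := hx.1.trans hx.2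
  rw [← uIcc_of_le hab] at hq hx ⊢
  exact intervalIntegral.continuousOn_primitive_interval' hq.intervalIntegrable hx

lemma hasDerivAt_primitive (hq : ContinuousOn q (Icc a b)) (hx : x ∈ Icc a b)
    (hr : r ∈ Ioo a b) : HasDerivAt (fun r => ∫ s in x..r, q s) (q r) r :=
  intervalIntegral.integral_hasDerivAt_right
    (intervalIntegrable_of_continuousOn hq hx (Ioo_subset_Icc_self hr))
    ((hq.mono Ioo_subset_Icc_self).stronglyMeasurableAtFilter isOpen_Ioo r hr)
    (hq.continuousAt (Icc_mem_nhds hr.1 hr.2))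

lemma sub_le_sub_of_hasDerivAt_le (hu : ContinuousOn u (Icc a b)) (hv : ContinuousOn v (Icc a b))
    (hu' : ∀ r ∈ Ioo a b, HasDerivAt u (u' r) r) (hv' : ∀ r ∈ Ioo a b, HasDerivAt v (v' r) r)
    (hle : ∀ r ∈ Ioo a b, u' r ≤ v' r) (hx : x ∈ Icc a b) (hy : y ∈ Icc a b) (hxy : x ≤ y) :
    u y - u x ≤ v y - v x := by
  have hmono : MonotoneOn (v - u) (Icc a b) := by
    refine monotoneOn_of_hasDerivWithinAt_nonneg (convex_Icc a b) (hv.sub hu)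
      (f' := fun r => v' r - u' r) (fun r hr => ?_) (fun r hr => ?_) <;>
      rw [interior_Icc] at *
    · exact ((hv' r hr).sub (hu' r hr)).hasDerivWithinAt
    · exact sub_nonneg.2 (hle r hr)
  have := hmono hx hy hxy
  simp only [Pi.sub_apply] at this
  linarith

lemma abs_sub_le_sub_of_abs_hasDerivAt_le (hu : ContinuousOn u (Icc a b))
    (hv : ContinuousOn v (Icc a b)) (hu' : ∀ r ∈ Ioo a b, HasDerivAt u (u' r) r)
    (hv' : ∀ r ∈ Ioo a b, HasDerivAt v (v' r) r) (hle : ∀ r ∈ Ioo a b, |u' r| ≤ v' r)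
    (hx : x ∈ Icc a b) (hy : y ∈ Icc a b) (hxy : x ≤ y) : |u y - u x| ≤ v y - v x := by
  have hup := sub_le_sub_of_hasDerivAt_le hu hv hu' hv'
    (fun r hr => (abs_le.1 (hle r hr)).2) hx hy hxy
  have hdown := sub_le_sub_of_hasDerivAt_le (u := fun r => -v r) hv.neg hu
    (fun r hr => (hv' r hr).neg) hu' (fun r hr => (abs_le.1 (hle r hr)).1) hx hy hxy
  exact abs_le.2 ⟨by linarith, hup⟩

end Calculus

section RadialAverage

variable {k : ℕ} {q q' : ℝ → ℝ} {r s lo hi B : ℝ}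

/-- The weighted average `∫₀¹ tᵏ q(ts) dt` of `q` over `[0, s]`. This form of
`s⁻⁽ᵏ⁺¹⁾ ∫₀ˢ τᵏ q(τ) dτ` has no singularity at `s = 0`. -/
def radialAvg (k : ℕ) (q : ℝ → ℝ) (s : ℝ) : ℝ := ∫ t in (0 : ℝ)..1, t ^ k * q (t * s)

lemma radialAvg_at_one (k : ℕ) (q : ℝ → ℝ) :
    radialAvg k q 1 = ∫ s in (0 : ℝ)..1, s ^ k * q s := by
  simp only [radialAvg, mul_one]

lemma pow_succ_mul_radialAvg (k : ℕ) (q : ℝ → ℝ) (s : ℝ) :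
    s ^ (k + 1) * radialAvg k q s = ∫ τ in (0 : ℝ)..s, τ ^ k * q τ := by
  have hcomp := intervalIntegral.mul_integral_comp_mul_right (a := 0) (b := 1) s
    (f := fun τ => τ ^ k * q τ)
  rw [zero_mul, one_mul] at hcomp
  rw [← hcomp, radialAvg, pow_succ', mul_assoc, ← intervalIntegral.integral_const_mul]
  simp only [mul_pow]
  congr 2 with t
  ring

lemma mul_radialAvg_eq_div (k : ℕ) (q : ℝ → ℝ) (s : ℝ) :
    s * radialAvg k q s = (∫ τ in (0 : ℝ)..s, τ ^ k * q τ) / s ^ k := by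
  rcases eq_or_ne s 0 with rfl | hs
  · simp
  · rw [← pow_succ_mul_radialAvg, eq_div_iff (pow_ne_zero k hs)]
    ring

lemma radialAvg_congr (k : ℕ) (h : EqOn q q' (Icc 0 1)) (hs : s ∈ Icc (0 : ℝ) 1) :
    radialAvg k q s = radialAvg k q' s := by
  refine intervalIntegral.integral_congr fun t ht => ?_
  rw [uIcc_of_le zero_le_one] at ht
  simp only [h (unitInterval.mul_mem ht hs)]

lemma continuous_radialAvg (k : ℕ) (hq : Continuous q) : Continuous (radialAvg k q) := by
  refine intervalIntegral.continuous_parametric_intervalIntegral_of_continuous' ?_ 0 1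
  simp only [Function.uncurry_def]
  fun_prop

lemma continuousOn_radialAvg (k : ℕ) (hq : ContinuousOn q (Icc 0 1)) :
    ContinuousOn (radialAvg k q) (Icc 0 1) := by
  have hext : EqOn (IccExtend zero_le_one ((Icc 0 1).domRestrict q)) q (Icc 0 1) := fun x hx => by
    rw [IccExtend_of_mem _ _ hx, domRestrict_apply]
  exact (continuous_radialAvg k hq.domRestrict.Icc_extend').continuousOn.congr
    fun _ hs => (radialAvg_congr k hext hs).symm

lemma intervalIntegrable_pow_mul_comp_mul (k : ℕ) (hs : 0 ≤ s) (hq : ContinuousOn q (Icc 0 s)) :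
    IntervalIntegrable (fun t => t ^ k * q (t * s)) volume 0 1 :=
  ContinuousOn.intervalIntegrable_of_Icc zero_le_one <|
    (continuous_pow k).continuousOn.mul <| hq.comp (by fun_prop) fun _ ht =>
      ⟨mul_nonneg ht.1 hs, mul_le_of_le_one_left hs ht.2⟩

lemma radialAvg_sub (k : ℕ) (hs : 0 ≤ s) (hq : ContinuousOn q (Icc 0 s))
    (hq' : ContinuousOn q' (Icc 0 s)) :
    radialAvg k (fun x => q x - q' x) s = radialAvg k q s - radialAvg k q' s := by
  simp only [radialAvg, mul_sub]
  exact intervalIntegral.integral_sub (intervalIntegrable_pow_mul_comp_mul k hs hq)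
    (intervalIntegrable_pow_mul_comp_mul k hs hq')

lemma radialAvg_const (k : ℕ) (B s : ℝ) : radialAvg k (fun _ => B) s = B / (k + 1) := by
  rw [radialAvg, intervalIntegral.integral_mul_const, integral_pow]
  simp only [one_pow, zero_pow (Nat.succ_ne_zero _), sub_zero]
  ring

lemma radialAvg_mono (k : ℕ) (hs : 0 ≤ s) (hq : ContinuousOn q (Icc 0 s))
    (hq' : ContinuousOn q' (Icc 0 s)) (h : ∀ x ∈ Icc 0 s, q x ≤ q' x) :
    radialAvg k q s ≤ radialAvg k q' s :=
  intervalIntegral.integral_mono_on zero_le_one (intervalIntegrable_pow_mul_comp_mul k hs hq)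
    (intervalIntegrable_pow_mul_comp_mul k hs hq') fun _ ht =>
      mul_le_mul_of_nonneg_left (h _ ⟨mul_nonneg ht.1 hs, mul_le_of_le_one_left hs ht.2⟩)
        (pow_nonneg ht.1 k)

lemma radialAvg_le (k : ℕ) (hs : 0 ≤ s) (hq : ContinuousOn q (Icc 0 s))
    (h : ∀ x ∈ Icc 0 s, q x ≤ hi) : radialAvg k q s ≤ hi / (k + 1) :=
  radialAvg_const k hi s ▸ radialAvg_mono k hs hq continuousOn_const h

lemma le_radialAvg (k : ℕ) (hs : 0 ≤ s) (hq : ContinuousOn q (Icc 0 s))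
    (h : ∀ x ∈ Icc 0 s, lo ≤ q x) : lo / (k + 1) ≤ radialAvg k q s :=
  radialAvg_const k lo s ▸ radialAvg_mono k hs continuousOn_const hq h

lemma abs_radialAvg_le (k : ℕ) (hs : 0 ≤ s) (hq : ContinuousOn q (Icc 0 s))
    (h : ∀ x ∈ Icc 0 s, |q x| ≤ B) : |radialAvg k q s| ≤ B / (k + 1) := by
  rw [abs_le, ← neg_div]
  exact ⟨le_radialAvg k hs hq fun x hx => (abs_le.1 (h x hx)).1,
    radialAvg_le k hs hq fun x hx => (abs_le.1 (h x hx)).2⟩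

lemma continuous_mul_radialAvg (k : ℕ) (hq : Continuous q) :
    Continuous fun s => s * radialAvg k q s :=
  continuous_id.mul (continuous_radialAvg k hq)

lemma hasDerivAt_mul_radialAvg (k : ℕ) (hq : Continuous q) (r : ℝ) :
    HasDerivAt (fun s => s * radialAvg k q s) (q r - k * radialAvg k q r) r := by
  rcases eq_or_ne r 0 with rfl | hr
  · have havg : q 0 - k * radialAvg k q 0 = radialAvg k q 0 := by
      have : radialAvg k q 0 = q 0 / (k + 1) := by
        rw [← radialAvg_const k (q 0) 0]
        simp only [radialAvg, mul_zero]
      rw [this]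
      field_simp
      ring
    rw [havg, hasDerivAt_iff_tendsto_slope]
    refine ((continuous_radialAvg k hq).tendsto 0 |>.mono_left nhdsWithin_le_nhds).congr' ?_
    filter_upwards [self_mem_nhdsWithin] with s hs
    rw [slope_def_field, zero_mul, sub_zero, sub_zero, mul_div_cancel_left₀ _ hs]
  · have hprim : HasDerivAt (fun s => ∫ τ in (0 : ℝ)..s, τ ^ k * q τ) (r ^ k * q r) r :=
      (Continuous.integral_hasStrictDerivAt (by fun_prop) 0 r).hasDerivAt
    simp only [mul_radialAvg_eq_div]
    refine (hprim.div (hasDerivAt_pow k r) (pow_ne_zero k hr)).congr_deriv ?_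
    rw [← pow_succ_mul_radialAvg]
    rcases k with _ | k
    · simp
    · simp only [Nat.add_sub_cancel]
      field_simp
      ring

end RadialAverage

section Existence

variable {k n : ℕ} {q q' μ F : ℝ → ℝ} {r B : ℝ}

/-- The radial Newtonian potential of `q`: the solution of `V'' + k/r V' = q` with `V(0) = 0` and
`V'(0) = 0`. -/
def radialPotential (k : ℕ) (q : ℝ → ℝ) (r : ℝ) : ℝ := ∫ s in (0 : ℝ)..r, s * radialAvg k q s

lemma hasDerivAt_radialPotential (k : ℕ) (hq : Continuous q) (r : ℝ) :
    HasDerivAt (radialPotential k q) (r * radialAvg k q r) r :=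
  ((continuous_mul_radialAvg k hq).integral_hasStrictDerivAt 0 r).hasDerivAt

lemma continuous_radialPotential (k : ℕ) (hq : Continuous q) : Continuous (radialPotential k q) :=
  continuous_iff_continuousAt.2 fun r => (hasDerivAt_radialPotential k hq r).continuousAt

lemma radialPotential_sub (k : ℕ) (hr : 0 ≤ r) (hq : Continuous q) (hq' : Continuous q') :
    radialPotential k (fun x => q x - q' x) r = radialPotential k q r - radialPotential k q' r := by
  simp only [radialPotential]
  rw [← intervalIntegral.integral_sub ((continuous_mul_radialAvg k hq).intervalIntegrable 0 r)
    ((continuous_mul_radialAvg k hq').intervalIntegrable 0 r)]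
  refine intervalIntegral.integral_congr fun s hs => ?_
  rw [uIcc_of_le hr] at hs
  simp only [radialAvg_sub k hs.1 hq.continuousOn hq'.continuousOn, mul_sub]

lemma abs_radialPotential_le (k : ℕ) (hr : 0 ≤ r) (hq : Continuous q) (hB : 0 ≤ B)
    (h : ∀ x ∈ Icc 0 r, |q x| ≤ B * x ^ n) :
    |radialPotential k q r| ≤ B * r ^ (n + 2) / (n + 2) := by
  have havg : ∀ s ∈ Ioc 0 r, |s * radialAvg k q s| ≤ B * s ^ (n + 1) := fun s hs => by
    have hle := abs_radialAvg_le (B := B * s ^ n) k hs.1.le hq.continuousOn fun x hx =>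
      (h x ⟨hx.1, hx.2.trans hs.2⟩).trans
        (mul_le_mul_of_nonneg_left (pow_le_pow_left₀ hx.1 hx.2 n) hB)
    have hk : B * s ^ n / (k + 1) ≤ B * s ^ n :=
      div_le_self (mul_nonneg hB (pow_nonneg hs.1.le n)) (by linarith [k.cast_nonneg (α := ℝ)])
    rw [abs_mul, abs_of_pos hs.1, pow_succ']
    linarith [mul_le_mul_of_nonneg_left (hle.trans hk) hs.1.le]
  calc |radialPotential k q r| ≤ ∫ s in (0 : ℝ)..r, B * s ^ (n + 1) :=
        intervalIntegral.norm_integral_le_of_norm_le (f := fun s => s * radialAvg k q s) hr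
          (.of_forall havg) (Continuous.intervalIntegrable (by fun_prop) _ _)
    _ = B * r ^ (n + 2) / (n + 2) := by
        rw [intervalIntegral.integral_const_mul, integral_pow]
        push_cast
        rw [zero_pow (Nat.succ_ne_zero _)]
        ring

/-- The Picard operator of the radial equation `F'' + k/r F' + μF = 0`, `F(0) = 1`. -/
def picardMap (k : ℕ) (μ u : C(Icc (0 : ℝ) 1, ℝ)) : C(Icc (0 : ℝ) 1, ℝ) where
  toFun r := 1 - radialPotential k (IccExtend zero_le_one (μ * u)) r
  continuous_toFun := continuous_const.sub <|
    (continuous_radialPotential k (μ * u).continuous.Icc_extend').comp continuous_subtype_val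

lemma abs_iterate_picardMap_sub_le (k : ℕ) (μ u v : C(Icc (0 : ℝ) 1, ℝ)) (n : ℕ)
    (r : Icc (0 : ℝ) 1) :
    |(picardMap k μ)^[n] u r - (picardMap k μ)^[n] v r|
      ≤ (‖μ‖ / 2) ^ n / n.factorial * dist u v * r ^ (2 * n) := by
  induction n generalizing r with
  | zero => simpa [← Real.dist_eq] using ContinuousMap.dist_apply_le_dist r
  | succ n ih =>
    rw [Function.iterate_succ_apply', Function.iterate_succ_apply']
    set U := (picardMap k μ)^[n] u
    set V := (picardMap k μ)^[n] v
    have hU : Continuous (IccExtend zero_le_one (μ * U)) := (μ * U).continuous.Icc_extend'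
    have hV : Continuous (IccExtend zero_le_one (μ * V)) := (μ * V).continuous.Icc_extend'
    have hdiff : picardMap k μ V r - picardMap k μ U r = radialPotential k
        (fun x => IccExtend zero_le_one (μ * U) x - IccExtend zero_le_one (μ * V) x) r := by
      rw [radialPotential_sub k r.2.1 hU hV]
      exact sub_sub_sub_cancel_left _ _ _
    have hdata : ∀ x ∈ Icc (0 : ℝ) r,
        |IccExtend zero_le_one (μ * U) x - IccExtend zero_le_one (μ * V) x|
          ≤ ‖μ‖ * ((‖μ‖ / 2) ^ n / n.factorial * dist u v) * x ^ (2 * n) := fun x hx => by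
      have hx1 : x ∈ Icc (0 : ℝ) 1 := ⟨hx.1, hx.2.trans r.2.2⟩
      rw [IccExtend_of_mem _ _ hx1, IccExtend_of_mem _ _ hx1, ContinuousMap.mul_apply,
        ContinuousMap.mul_apply, ← mul_sub, abs_mul, mul_assoc]
      exact mul_le_mul (μ.norm_coe_le_norm _) (ih ⟨x, hx1⟩) (abs_nonneg _) (norm_nonneg _)
    rw [abs_sub_comm, hdiff]
    refine (abs_radialPotential_le k r.2.1 (hU.sub hV) (by positivity) hdata).trans_eq ?_
    rw [Nat.factorial_succ]
    push_cast
    field_simp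
    ring

lemma exists_picardMap_eq_self (k : ℕ) (μ : C(Icc (0 : ℝ) 1, ℝ)) : ∃ u, picardMap k μ u = u := by
  obtain ⟨n, hn⟩ := ((FloorSemiring.tendsto_pow_div_factorial_atTop (‖μ‖ / 2)).eventually
    (gt_mem_nhds zero_lt_one)).exists
  have hK : 0 ≤ (‖μ‖ / 2) ^ n / n.factorial := by positivity
  have hcontr : ContractingWith ⟨_, hK⟩ (picardMap k μ)^[n] := by
    refine ⟨by exact_mod_cast hn, LipschitzWith.of_dist_le_mul fun u v => ?_⟩
    rw [ContinuousMap.dist_le (by positivity)]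
    exact fun r => (abs_iterate_picardMap_sub_le k μ u v n r).trans
      (mul_le_of_le_one_right (by positivity) (pow_le_one₀ r.2.1 r.2.2))
  exact ⟨_, hcontr.isFixedPt_fixedPoint_iterate⟩

lemma contDiff_radialPotential (k : ℕ) (hq : Continuous q) :
    ContDiff ℝ 2 (radialPotential k q) := by
  have hderiv : deriv (radialPotential k q) = fun r => r * radialAvg k q r :=
    funext fun r => (hasDerivAt_radialPotential k hq r).deriv
  have hderiv' : deriv (fun r => r * radialAvg k q r) = fun r => q r - k * radialAvg k q r :=
    funext fun r => (hasDerivAt_mul_radialAvg k hq r).deriv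
  have hcont := continuous_radialAvg k hq
  rw [show (2 : WithTop ℕ∞) = 1 + 1 by norm_num, contDiff_succ_iff_deriv, hderiv,
    contDiff_one_iff_deriv, hderiv']
  exact ⟨fun r => (hasDerivAt_radialPotential k hq r).differentiableAt, by simp,
    fun r => (hasDerivAt_mul_radialAvg k hq r).differentiableAt, by fun_prop⟩

theorem exists_contDiffOn_radial_solution (k : ℕ) (hμ : ContinuousOn μ (Icc 0 1)) :
    ∃ F : ℝ → ℝ, ContDiffOn ℝ 2 F (Icc 0 1) ∧ F 0 = 1 ∧ ∀ r ∈ Ioc (0 : ℝ) 1,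
      derivWithin (derivWithin F (Icc 0 1)) (Icc 0 1) r
        + k / r * derivWithin F (Icc 0 1) r + μ r * F r = 0 := by
  let μ' : C(Icc (0 : ℝ) 1, ℝ) := ⟨_, hμ.domRestrict⟩
  obtain ⟨u, hu⟩ := exists_picardMap_eq_self k μ'
  set q : ℝ → ℝ := IccExtend zero_le_one (μ' * u)
  have hq : Continuous q := (μ' * u).continuous.Icc_extend'
  set F : ℝ → ℝ := fun r => 1 - radialPotential k q r
  have hF : ∀ r, HasDerivAt F (-(r * radialAvg k q r)) r := fun r =>
    (hasDerivAt_radialPotential k hq r).const_sub 1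
  have hF' : ∀ r, HasDerivAt (fun r => -(r * radialAvg k q r)) (-(q r - k * radialAvg k q r)) r :=
    fun r => (hasDerivAt_mul_radialAvg k hq r).neg
  have huniq := uniqueDiffOn_Icc (zero_lt_one' ℝ)
  have hderiv : EqOn (derivWithin F (Icc 0 1)) (fun r => -(r * radialAvg k q r)) (Icc 0 1) :=
    fun r hr => (hF r).hasDerivWithinAt.derivWithin (huniq r hr)
  refine ⟨F, (contDiff_const.sub (contDiff_radialPotential k hq)).contDiffOn,
    by simp [F, radialPotential], fun r hr => ?_⟩
  have hr' : r ∈ Icc (0 : ℝ) 1 := Ioc_subset_Icc_self hr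
  have hqr : q r = μ r * F r := by
    have hFu : F r = u ⟨r, hr'⟩ := DFunLike.congr_fun hu ⟨r, hr'⟩
    simp only [q, IccExtend_of_mem _ _ hr', hFu]
    rfl
  rw [derivWithin_congr hderiv (hderiv hr'), hderiv hr',
    (hF' r).hasDerivWithinAt.derivWithin (huniq r hr'), hqr]
  have := hr.1.ne'
  field_simp
  ring

end Existence

section RadialSolution

variable {k : ℕ} {μ F : ℝ → ℝ} {r C δ S : ℝ}

/-- `F` solves `F'' + k/r F' + μF = 0`, `F(0) = 1`, written in the integrated form
`rᵏ F'(r) = -∫₀ʳ sᵏ μ(s) F(s) ds`, which involves only one derivative. -/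
structure IsRadialSolution (k : ℕ) (μ F : ℝ → ℝ) : Prop where
  continuousOn : ContinuousOn F (Icc 0 1)
  apply_zero : F 0 = 1
  hasDerivAt : ∀ r ∈ Ioo (0 : ℝ) 1, HasDerivAt F (-(r * radialAvg k (fun s => μ s * F s) r)) r

lemma isRadialSolution_of_contDiffOn (hk : k ≠ 0) (hμ : ContinuousOn μ (Icc 0 1))
    (hF : ContDiffOn ℝ 2 F (Icc 0 1)) (hF0 : F 0 = 1)
    (hode : ∀ r ∈ Ioo (0 : ℝ) 1, derivWithin (derivWithin F (Icc 0 1)) (Icc 0 1) r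
      + k / r * derivWithin F (Icc 0 1) r + μ r * F r = 0) : IsRadialSolution k μ F := by
  set F' := derivWithin F (Icc 0 1)
  have hF' : ContDiffOn ℝ 1 F' (Icc 0 1) :=
    hF.derivWithin (uniqueDiffOn_Icc zero_lt_one) (by norm_num)
  have hderiv : ∀ {u : ℝ → ℝ} {n}, ContDiffOn ℝ n u (Icc 0 1) → n ≠ 0 → ∀ r ∈ Ioo (0 : ℝ) 1,
      HasDerivAt u (derivWithin u (Icc 0 1) r) r := fun hu hn r hr =>
    (hu.differentiableOn hn r (Ioo_subset_Icc_self hr)).hasDerivWithinAt.hasDerivAt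
      (Icc_mem_nhds hr.1 hr.2)
  refine ⟨hF.continuousOn, hF0, fun r hr => (hderiv hF two_ne_zero r hr).congr_deriv ?_⟩
  have hsub : Icc 0 r ⊆ Icc (0 : ℝ) 1 := Icc_subset_Icc_right hr.2.le
  have hdata : ContinuousOn (fun s => -(s ^ k * (μ s * F s))) (Icc 0 1) :=
    ((continuous_pow k).continuousOn.mul (hμ.mul hF.continuousOn)).neg
  have hflux := intervalIntegral.integral_eq_sub_of_hasDerivAt_of_le (a := 0) (b := r) hr.1.le
    (f := fun s => s ^ k * F' s) ((continuous_pow k).continuousOn.mul (hF'.continuousOn.mono hsub))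
    (fun s hs => by
      have hs1 : s ∈ Ioo (0 : ℝ) 1 := ⟨hs.1, hs.2.trans hr.2⟩
      refine ((hasDerivAt_pow k s).mul (hderiv hF' one_ne_zero s hs1)).congr_deriv
        (g' := -(s ^ k * (μ s * F s))) ?_
      rw [← mul_pow_sub_one hk s, eq_neg_of_add_eq_zero_right (hode s hs1)]
      have := hs.1.ne'
      field_simp
      ring)
    (intervalIntegrable_of_continuousOn hdata ⟨le_rfl, zero_le_one⟩ (Ioo_subset_Icc_self hr))
  rw [intervalIntegral.integral_neg, ← pow_succ_mul_radialAvg, zero_pow hk, zero_mul, sub_zero,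
    pow_succ] at hflux
  refine mul_left_cancel₀ (pow_ne_zero k hr.1.ne') ?_
  rw [← hflux]
  ring

/-- The energy argument: `∫₀ʳ sᵏ μF` times `F` is nonincreasing. -/
lemma IsRadialSolution.radialAvg_mul_nonpos (hF : IsRadialSolution k μ F)
    (hμ : ContinuousOn μ (Icc 0 1)) (hμ0 : ∀ s ∈ Icc (0 : ℝ) 1, μ s ≤ 0) (hr : r ∈ Ioo (0 : ℝ) 1) :
    radialAvg k (fun s => μ s * F s) r * F r ≤ 0 := by
  have h0 : (0 : ℝ) ∈ Icc (0 : ℝ) 1 := ⟨le_rfl, zero_le_one⟩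
  have hdata : ContinuousOn (fun s => s ^ k * (μ s * F s)) (Icc 0 1) :=
    (continuous_pow k).continuousOn.mul (hμ.mul hF.continuousOn)
  have henergy := sub_le_sub_of_hasDerivAt_le (v := fun _ => 0) (v' := fun _ => 0)
    ((continuousOn_primitive hdata h0).mul hF.continuousOn) continuousOn_const
    (fun s hs => (hasDerivAt_primitive hdata h0 hs).mul (hF.hasDerivAt s hs))
    (fun s _ => hasDerivAt_const s 0) (fun s hs => by
      rw [← pow_succ_mul_radialAvg k (fun s => μ s * F s)]
      have hsource := mul_nonpos_of_nonpos_of_nonneg (hμ0 s (Ioo_subset_Icc_self hs))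
        (mul_nonneg (pow_nonneg hs.1.le k) (sq_nonneg (F s)))
      have hflux := mul_nonneg (pow_nonneg hs.1.le (k + 2))
        (sq_nonneg (radialAvg k (fun s => μ s * F s) s))
      rw [pow_succ s (k + 1)] at hflux
      linarith) h0 (Ioo_subset_Icc_self hr) hr.1.le
  simp only [Pi.mul_apply, ← pow_succ_mul_radialAvg, mul_assoc, zero_pow (Nat.succ_ne_zero k),
    zero_mul, sub_zero] at henergy
  exact nonpos_of_mul_nonpos_right henergy (pow_pos hr.1 _)

lemma IsRadialSolution.one_le (hF : IsRadialSolution k μ F) (hμ : ContinuousOn μ (Icc 0 1))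
    (hμ0 : ∀ s ∈ Icc (0 : ℝ) 1, μ s ≤ 0) (hr : r ∈ Icc (0 : ℝ) 1) : 1 ≤ F r := by
  have h0 : (0 : ℝ) ∈ Icc (0 : ℝ) 1 := ⟨le_rfl, zero_le_one⟩
  have hsq : ∀ s ∈ Icc (0 : ℝ) 1, 1 ≤ F s ^ 2 := fun s hs => by
    have := sub_le_sub_of_hasDerivAt_le (u := fun _ => 0) continuousOn_const
      (hF.continuousOn.pow 2) (fun s _ => hasDerivAt_const s 0)
      (fun s hs => (hF.hasDerivAt s hs).pow 2) (fun s hs => by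
        have := mul_nonpos_of_nonneg_of_nonpos hs.1.le (hF.radialAvg_mul_nonpos hμ hμ0 hs)
        norm_num
        linarith) h0 hs hs.1
    simp only [Pi.pow_apply, hF.apply_zero] at this
    linarith
  have hpos : 0 < F r := by
    by_contra! hneg
    obtain ⟨z, hz, hFz⟩ := intermediate_value_Icc' hr.1
      (hF.continuousOn.mono (Icc_subset_Icc_right hr.2))
      (⟨hneg, by rw [hF.apply_zero]; exact zero_le_one⟩ : (0 : ℝ) ∈ Icc (F r) (F 0))
    have := hsq z ⟨hz.1, hz.2.trans hr.2⟩
    rw [hFz] at this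
    norm_num at this
  exact (one_le_sq_iff₀ hpos.le).1 (hsq r hr)

lemma IsRadialSolution.monotoneOn (hF : IsRadialSolution k μ F) (hμ : ContinuousOn μ (Icc 0 1))
    (hμ0 : ∀ s ∈ Icc (0 : ℝ) 1, μ s ≤ 0) : MonotoneOn F (Icc 0 1) := fun x hx y hy hxy => by
  have := sub_le_sub_of_hasDerivAt_le (u := fun _ => 0) continuousOn_const hF.continuousOn
    (fun s _ => hasDerivAt_const s 0) hF.hasDerivAt (fun s hs => by
      have hFs := hF.one_le hμ hμ0 (Ioo_subset_Icc_self hs)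
      have havg := nonpos_of_mul_nonpos_left (hF.radialAvg_mul_nonpos hμ hμ0 hs)
        (zero_lt_one.trans_le hFs)
      linarith [mul_nonpos_of_nonneg_of_nonpos hs.1.le havg]) hx hy hxy
  linarith

lemma IsRadialSolution.abs_sub_one_le_log (hF : IsRadialSolution k μ F)
    (hμ : ContinuousOn μ (Icc 0 1)) (hC : 0 ≤ C) (hδ : 0 < δ)
    (hμle : ∀ s ∈ Icc (0 : ℝ) 1, |μ s| ≤ C / (δ + 1 - s ^ 2)) (hS : ∀ s ∈ Icc (0 : ℝ) 1, |F s| ≤ S)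
    (hr : r ∈ Icc (0 : ℝ) 1) :
    |F r - 1| ≤ C * S / (2 * (k + 1)) * Real.log (1 + 1 / δ) := by
  have h0 : (0 : ℝ) ∈ Icc (0 : ℝ) 1 := ⟨le_rfl, zero_le_one⟩
  have hS0 : 0 ≤ S := (abs_nonneg _).trans (hS 0 h0)
  have hden : ∀ s ∈ Icc (0 : ℝ) 1, δ ≤ δ + 1 - s ^ 2 := fun s hs => by
    linarith [pow_le_one₀ (n := 2) hs.1 hs.2]
  have havg : ∀ s ∈ Ioo (0 : ℝ) 1,
      |radialAvg k (fun x => μ x * F x) s| ≤ C / (δ + 1 - s ^ 2) * S / (k + 1) := fun s hs => by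
    have hsub : Icc 0 s ⊆ Icc (0 : ℝ) 1 := Icc_subset_Icc_right hs.2.le
    refine abs_radialAvg_le k hs.1.le ((hμ.mul hF.continuousOn).mono hsub) fun x hx => ?_
    have hle : C / (δ + 1 - x ^ 2) ≤ C / (δ + 1 - s ^ 2) :=
      div_le_div_of_nonneg_left hC (hδ.trans_le (hden s (Ioo_subset_Icc_self hs)))
        (by linarith [pow_le_pow_left₀ hx.1 hx.2 2])
    rw [abs_mul]
    exact mul_le_mul ((hμle x (hsub hx)).trans hle) (hS x (hsub hx)) (abs_nonneg _)
      ((abs_nonneg _).trans ((hμle x (hsub hx)).trans hle))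
  have hcomp := abs_sub_le_sub_of_abs_hasDerivAt_le
    (v := fun s => C * S / (2 * (k + 1)) * -Real.log (δ + 1 - s ^ 2)) hF.continuousOn
    (continuousOn_const.mul (ContinuousOn.log (by fun_prop)
      fun s hs => (hδ.trans_le (hden s hs)).ne').neg) hF.hasDerivAt
    (fun s hs => (((((hasDerivAt_pow 2 s).const_sub (δ + 1)).log
      (hδ.trans_le (hden s (Ioo_subset_Icc_self hs))).ne').neg).const_mul _))
    (fun s hs => by
      have hpos := hδ.trans_le (hden s (Ioo_subset_Icc_self hs))
      rw [abs_neg, abs_mul, abs_of_pos hs.1]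
      refine (mul_le_mul_of_nonneg_left (havg s hs) hs.1.le).trans_eq ?_
      push_cast
      field_simp) h0 hr hr.1
  rw [hF.apply_zero] at hcomp
  refine hcomp.trans ?_
  rw [← mul_sub]
  refine mul_le_mul_of_nonneg_left ?_ (by positivity)
  have hlog := Real.log_le_log hδ (hden r hr)
  rw [one_add_div hδ.ne', Real.log_div (by positivity) hδ.ne']
  norm_num
  linarith

lemma IsRadialSolution.abs_sub_one_le (hF : IsRadialSolution k μ F)
    (hμ : ContinuousOn μ (Icc 0 1)) (hC : 0 ≤ C) (hδ : 0 < δ)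
    (hμle : ∀ s ∈ Icc (0 : ℝ) 1, |μ s| ≤ C / (δ + 1 - s ^ 2))
    (hsmall : C * Real.log (1 + 1 / δ) ≤ (k + 1) / 2) (hr : r ∈ Icc (0 : ℝ) 1) :
    |F r - 1| ≤ 1 / 3 := by
  obtain ⟨z, hz, hmax⟩ := isCompact_Icc.exists_isMaxOn (nonempty_Icc.2 zero_le_one)
    hF.continuousOn.abs
  have hquarter : ∀ s ∈ Icc (0 : ℝ) 1, |F s - 1| ≤ |F z| / 4 := fun s hs => by
    refine (hF.abs_sub_one_le_log hμ hC hδ hμle (fun x hx => hmax hx) hs).trans ?_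
    calc C * |F z| / (2 * (k + 1)) * Real.log (1 + 1 / δ)
        = |F z| / (2 * (k + 1)) * (C * Real.log (1 + 1 / δ)) := by ring
      _ ≤ |F z| / (2 * (k + 1)) * ((k + 1) / 2) := by gcongr
      _ = |F z| / 4 := by field_simp; norm_num
  have hFz : |F z| ≤ |F z - 1| + 1 := by
    simpa using abs_add_le (F z - 1) 1
  linarith [hquarter z hz, hquarter r hr]

end RadialSolution

section VariationOfConstants

variable {k : ℕ} {μ F b : ℝ → ℝ} {r B C : ℝ}

/-- The function `Φ(r) = ∫₁ʳ (F(s)² sᵏ)⁻¹ ∫₀ˢ τᵏ F(τ) b(τ) dτ ds` of the method of variation of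
constants: if `F` solves the radial equation, `FΦ` solves it with right-hand side `b` and vanishes
at `1`. -/
def varConst (k : ℕ) (F b : ℝ → ℝ) (r : ℝ) : ℝ :=
  ∫ s in (1 : ℝ)..r, s * radialAvg k (fun x => F x * b x) s / F s ^ 2

lemma varConst_at_one (k : ℕ) (F b : ℝ → ℝ) : varConst k F b 1 = 0 :=
  intervalIntegral.integral_same

lemma continuousOn_varConst_integrand (k : ℕ) (hF : ContinuousOn F (Icc 0 1))
    (hb : ContinuousOn b (Icc 0 1)) (hF0 : ∀ r ∈ Icc (0 : ℝ) 1, F r ≠ 0) :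
    ContinuousOn (fun s => s * radialAvg k (fun x => F x * b x) s / F s ^ 2) (Icc 0 1) :=
  (continuousOn_id.mul (continuousOn_radialAvg k (hF.mul hb))).div (hF.pow 2)
    fun r hr => pow_ne_zero 2 (hF0 r hr)

lemma continuousOn_varConst (k : ℕ) (hF : ContinuousOn F (Icc 0 1))
    (hb : ContinuousOn b (Icc 0 1)) (hF0 : ∀ r ∈ Icc (0 : ℝ) 1, F r ≠ 0) :
    ContinuousOn (varConst k F b) (Icc 0 1) :=
  continuousOn_primitive (continuousOn_varConst_integrand k hF hb hF0) ⟨zero_le_one, le_rfl⟩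

lemma hasDerivAt_varConst (k : ℕ) (hF : ContinuousOn F (Icc 0 1))
    (hb : ContinuousOn b (Icc 0 1)) (hF0 : ∀ r ∈ Icc (0 : ℝ) 1, F r ≠ 0) (hr : r ∈ Ioo (0 : ℝ) 1) :
    HasDerivAt (varConst k F b) (r * radialAvg k (fun x => F x * b x) r / F r ^ 2) r :=
  hasDerivAt_primitive (continuousOn_varConst_integrand k hF hb hF0) ⟨zero_le_one, le_rfl⟩ hr

/-- With `P(r) = ∫₀ʳ sᵏ μF` and `Q(r) = ∫₀ʳ sᵏ Fb`, the difference of the two integrands is the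
derivative of `PΦ - Q/F`. -/
lemma IsRadialSolution.integral_mul_varConst (hF : IsRadialSolution k μ F)
    (hμ : ContinuousOn μ (Icc 0 1)) (hb : ContinuousOn b (Icc 0 1))
    (hF0 : ∀ r ∈ Icc (0 : ℝ) 1, F r ≠ 0) :
    ∫ r in (0 : ℝ)..1, r ^ k * (μ r * F r * varConst k F b r)
      = (∫ r in (0 : ℝ)..1, r ^ k * b r) - (∫ r in (0 : ℝ)..1, r ^ k * (F r * b r)) / F 1 := by
  have h0 : (0 : ℝ) ∈ Icc (0 : ℝ) 1 := ⟨le_rfl, zero_le_one⟩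
  have h1 : (1 : ℝ) ∈ Icc (0 : ℝ) 1 := ⟨zero_le_one, le_rfl⟩
  have hpow : ContinuousOn (fun r : ℝ => r ^ k) (Icc 0 1) := (continuous_pow k).continuousOn
  have hΦ := continuousOn_varConst k hF.continuousOn hb hF0
  have hP : ContinuousOn (fun r => r ^ k * (μ r * F r)) (Icc 0 1) :=
    hpow.mul (hμ.mul hF.continuousOn)
  have hQ : ContinuousOn (fun r => r ^ k * (F r * b r)) (Icc 0 1) :=
    hpow.mul (hF.continuousOn.mul hb)
  have hμFΦ := intervalIntegrable_of_continuousOn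
    (hpow.mul ((hμ.mul hF.continuousOn).mul hΦ)) h0 h1
  have hbint := intervalIntegrable_of_continuousOn (hpow.mul hb) h0 h1
  have hftc := intervalIntegral.integral_eq_sub_of_hasDerivAt_of_le zero_le_one
    (((continuousOn_primitive hP h0).mul hΦ).sub
      ((continuousOn_primitive hQ h0).div hF.continuousOn hF0))
    (fun r hr => by
      refine (((hasDerivAt_primitive hP h0 hr).mul
        (hasDerivAt_varConst k hF.continuousOn hb hF0 hr)).sub
        ((hasDerivAt_primitive hQ h0 hr).div (hF.hasDerivAt r hr)
          (hF0 r (Ioo_subset_Icc_self hr)))).congr_deriv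
        (g' := r ^ k * (μ r * F r * varConst k F b r) - r ^ k * b r) ?_
      rw [← pow_succ_mul_radialAvg k (fun x => F x * b x),
        ← pow_succ_mul_radialAvg k (fun x => μ x * F x)]
      have := hF0 r (Ioo_subset_Icc_self hr)
      field_simp
      ring)
    (hμFΦ.sub hbint)
  rw [intervalIntegral.integral_sub hμFΦ hbint] at hftc
  simp only [Pi.sub_apply, Pi.mul_apply, Pi.div_apply, varConst_at_one, mul_zero,
    intervalIntegral.integral_same, zero_div, zero_mul, sub_zero] at hftc
  linarith

lemma abs_varConst_le (hF : ContinuousOn F (Icc 0 1)) (hb : ContinuousOn b (Icc 0 1))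
    (hF0 : ∀ r ∈ Icc (0 : ℝ) 1, F r ≠ 0) (hr : r ∈ Icc (0 : ℝ) 1)
    (hC : ∀ s ∈ Ioo r 1, |radialAvg k (fun x => F x * b x) s| ≤ C * F s ^ 2) :
    |varConst k F b r| ≤ C / 2 * (1 - r ^ 2) := by
  have hsub : Icc r 1 ⊆ Icc (0 : ℝ) 1 := Icc_subset_Icc_left hr.1
  have hcomp := abs_sub_le_sub_of_abs_hasDerivAt_le (v := fun s => C / 2 * s ^ 2)
    ((continuousOn_varConst k hF hb hF0).mono hsub) (by fun_prop)
    (fun s hs => hasDerivAt_varConst k hF hb hF0 ⟨hr.1.trans_lt hs.1, hs.2⟩)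
    (fun s _ => (hasDerivAt_pow 2 s).const_mul (C / 2)) (fun s hs => by
      have hs0 := hr.1.trans_lt hs.1
      have hsq : 0 < F s ^ 2 := pow_two_pos_of_ne_zero (hF0 s ⟨hs0.le, hs.2.le⟩)
      rw [abs_div, abs_mul, abs_of_pos hs0, abs_of_pos hsq, div_le_iff₀ hsq]
      refine (mul_le_mul_of_nonneg_left (hC s hs) hs0.le).trans_eq ?_
      norm_num
      ring) ⟨le_rfl, hr.2⟩ ⟨hr.2, le_rfl⟩ hr.2
  rw [varConst_at_one, zero_sub, abs_neg] at hcomp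
  linarith

lemma mul_abs_varConst_le_of_monotoneOn (hF : ContinuousOn F (Icc 0 1))
    (hmono : MonotoneOn F (Icc 0 1)) (hpos : ∀ r ∈ Icc (0 : ℝ) 1, 0 < F r)
    (hb : ContinuousOn b (Icc 0 1)) (hB : ∀ r ∈ Icc (0 : ℝ) 1, |b r| ≤ B)
    (hr : r ∈ Icc (0 : ℝ) 1) :
    F r * |varConst k F b r| ≤ B / (2 * (k + 1)) * (1 - r ^ 2) := by
  have hFr := hpos r hr
  have hB0 : 0 ≤ B := (abs_nonneg _).trans (hB r hr)
  have hΦ := abs_varConst_le (k := k) (C := B / ((k + 1) * F r)) hF hb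
    (fun s hs => (hpos s hs).ne') hr fun s hs => by
      have hs' : s ∈ Icc (0 : ℝ) 1 := ⟨hr.1.trans hs.1.le, hs.2.le⟩
      have hsub : Icc 0 s ⊆ Icc (0 : ℝ) 1 := Icc_subset_Icc_right hs'.2
      have hFs := hpos s hs'
      calc |radialAvg k (fun x => F x * b x) s| ≤ F s * B / (k + 1) :=
            abs_radialAvg_le k hs'.1 ((hF.mul hb).mono hsub) fun x hx => by
              rw [abs_mul, abs_of_pos (hpos x (hsub hx))]
              exact mul_le_mul (hmono (hsub hx) hs' hx.2) (hB x (hsub hx)) (abs_nonneg _) hFs.le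
        _ = B / ((k + 1) * F r) * F s * F r := by field_simp
        _ ≤ B / ((k + 1) * F r) * F s * F s :=
            mul_le_mul_of_nonneg_left (hmono hr hs' hs.1.le) (by positivity)
        _ = B / ((k + 1) * F r) * F s ^ 2 := by ring
  refine (mul_le_mul_of_nonneg_left hΦ hFr.le).trans_eq ?_
  field_simp

lemma mul_abs_varConst_le_of_abs_sub_one_le (hF : ContinuousOn F (Icc 0 1))
    (hclose : ∀ r ∈ Icc (0 : ℝ) 1, |F r - 1| ≤ 1 / 3)
    (hb : ContinuousOn b (Icc 0 1)) (hB : ∀ r ∈ Icc (0 : ℝ) 1, |b r| ≤ B)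
    (hr : r ∈ Icc (0 : ℝ) 1) :
    F r * |varConst k F b r| ≤ 2 * B / (k + 1) * (1 - r ^ 2) := by
  have hle : ∀ s ∈ Icc (0 : ℝ) 1, F s ≤ 4 / 3 := fun s hs => by
    linarith [(abs_le.1 (hclose s hs)).2]
  have hge : ∀ s ∈ Icc (0 : ℝ) 1, 2 / 3 ≤ F s := fun s hs => by
    linarith [(abs_le.1 (hclose s hs)).1]
  have hpos : ∀ s ∈ Icc (0 : ℝ) 1, 0 < F s := fun s hs => by linarith [hge s hs]
  have hB0 : 0 ≤ B := (abs_nonneg _).trans (hB r hr)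
  have hΦ := abs_varConst_le (k := k) (C := 3 * B / (k + 1)) hF hb
    (fun s hs => (hpos s hs).ne') hr fun s hs => by
      have hs' : s ∈ Icc (0 : ℝ) 1 := ⟨hr.1.trans hs.1.le, hs.2.le⟩
      have hsub : Icc 0 s ⊆ Icc (0 : ℝ) 1 := Icc_subset_Icc_right hs'.2
      calc |radialAvg k (fun x => F x * b x) s| ≤ 4 / 3 * B / (k + 1) :=
            abs_radialAvg_le k hs'.1 ((hF.mul hb).mono hsub) fun x hx => by
              rw [abs_mul, abs_of_pos (hpos x (hsub hx))]
              exact mul_le_mul (hle x (hsub hx)) (hB x (hsub hx)) (abs_nonneg _) (by norm_num)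
        _ = 3 * B / (k + 1) * (2 / 3) ^ 2 := by ring
        _ ≤ 3 * B / (k + 1) * F s ^ 2 := by
            gcongr
            exact hge s hs'
  calc F r * |varConst k F b r| ≤ 4 / 3 * (3 * B / (k + 1) / 2 * (1 - r ^ 2)) :=
        mul_le_mul (hle r hr) hΦ (abs_nonneg _) (by norm_num)
    _ = 2 * B / (k + 1) * (1 - r ^ 2) := by ring

end VariationOfConstants

section AverageIncrement

variable {j k : ℕ} {q : ℝ → ℝ} {r : ℝ}

lemma radialAvg_one_sub_radialAvg (k : ℕ) (hq : ContinuousOn q (Icc 0 1))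
    (hr : r ∈ Icc (0 : ℝ) 1) :
    radialAvg k q 1 - radialAvg k q r = ∫ t in (0 : ℝ)..1, t ^ k * (q t - q (t * r)) := by
  rw [radialAvg, radialAvg, ← intervalIntegral.integral_sub
    (intervalIntegrable_pow_mul_comp_mul k zero_le_one hq)
    (intervalIntegrable_pow_mul_comp_mul k hr.1 (hq.mono (Icc_subset_Icc_right hr.2)))]
  simp only [mul_one, mul_sub]

lemma radialAvg_increment_antitone (hjk : j ≤ k) (hq : ContinuousOn q (Icc 0 1))
    (hmono : MonotoneOn q (Icc 0 1)) (hr : r ∈ Icc (0 : ℝ) 1) :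
    radialAvg k q 1 - radialAvg k q r ≤ radialAvg j q 1 - radialAvg j q r := by
  have hmem : ∀ t ∈ Icc (0 : ℝ) 1, t * r ∈ Icc (0 : ℝ) 1 := fun t ht =>
    unitInterval.mul_mem ht hr
  have hint : ∀ n : ℕ, IntervalIntegrable (fun t => t ^ n * (q t - q (t * r)))
      volume 0 1 := fun n =>
    intervalIntegrable_of_continuousOn ((continuous_pow n).continuousOn.mul
      (hq.sub (hq.comp (by fun_prop) hmem))) ⟨le_rfl, zero_le_one⟩ ⟨zero_le_one, le_rfl⟩
  rw [radialAvg_one_sub_radialAvg k hq hr, radialAvg_one_sub_radialAvg j hq hr]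
  exact intervalIntegral.integral_mono_on zero_le_one (hint k) (hint j) fun t ht =>
    mul_le_mul_of_nonneg_right (pow_le_pow_of_le_one ht.1 ht.2 hjk)
      (sub_nonneg.2 (hmono (hmem t ht) ht (mul_le_of_le_one_right ht.1 hr.2)))

lemma radialAvg_le_radialAvg_one (k : ℕ) (hq : ContinuousOn q (Icc 0 1))
    (hmono : MonotoneOn q (Icc 0 1)) (hr : r ∈ Icc (0 : ℝ) 1) :
    radialAvg k q r ≤ radialAvg k q 1 := by
  rw [← sub_nonneg, radialAvg_one_sub_radialAvg k hq hr]
  exact intervalIntegral.integral_nonneg zero_le_one fun t ht => mul_nonneg (pow_nonneg ht.1 k)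
    (sub_nonneg.2 (hmono (unitInterval.mul_mem ht hr) ht (mul_le_of_le_one_right ht.1 hr.2)))

lemma radialAvg_const_mul_sq (k : ℕ) (C r : ℝ) :
    radialAvg k (fun x => C * x ^ 2) r = C * r ^ 2 / (k + 3) := by
  have : ∀ t : ℝ, t ^ k * (C * (t * r) ^ 2) = C * r ^ 2 * t ^ (k + 2) := fun t => by ring
  simp only [radialAvg, this, intervalIntegral.integral_const_mul, integral_pow]
  push_cast
  simp only [one_pow, zero_pow (Nat.succ_ne_zero _), sub_zero]
  ring

end AverageIncrement

section Profile

variable {f₀ g D : ℝ → ℝ} {c M r : ℝ}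

/-- `f₀'(r) = r D(r)` on `[0,1]`, with a continuous slope `D` that takes its values in the interval
`[c, M]` of positive numbers. -/
structure HasRadialSlope (f₀ D : ℝ → ℝ) (c M : ℝ) : Prop where
  pos : 0 < c
  continuousOn_slope : ContinuousOn D (Icc 0 1)
  slope_mem : ∀ r ∈ Icc (0 : ℝ) 1, D r ∈ Icc c M
  hasDerivWithinAt : ∀ r ∈ Icc (0 : ℝ) 1, HasDerivWithinAt f₀ (r * D r) (Icc 0 1) r

lemma exists_hasRadialSlope (hg : ContDiffOn ℝ 1 g (Icc 0 1))
    (hf₀ : ∀ r ∈ Icc (0 : ℝ) 1, f₀ r = g (r ^ 2)) (hmono : MonotoneProfile f₀) :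
    ∃ D c M, HasRadialSlope f₀ D c M := by
  obtain ⟨c, hc, hslope⟩ := hmono
  have hunique := uniqueDiffOn_Icc (zero_lt_one' ℝ)
  have hsq : MapsTo (fun r : ℝ => r ^ 2) (Icc 0 1) (Icc 0 1) := fun r hr =>
    ⟨sq_nonneg r, pow_le_one₀ hr.1 hr.2⟩
  set D : ℝ → ℝ := fun r => 2 * derivWithin g (Icc 0 1) (r ^ 2)
  have hD : ContinuousOn D (Icc 0 1) := continuousOn_const.mul
    ((hg.continuousOn_derivWithin hunique le_rfl).comp (by fun_prop) hsq)
  have hderiv : ∀ r ∈ Icc (0 : ℝ) 1, HasDerivWithinAt f₀ (r * D r) (Icc 0 1) r := fun r hr => by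
    have hcomp := HasDerivWithinAt.comp (h := fun r : ℝ => r ^ 2) r
      ((hg.differentiableOn one_ne_zero _ (hsq hr)).hasDerivWithinAt)
      ((hasDerivAt_pow 2 r).hasDerivWithinAt (s := Icc 0 1)) hsq
    refine (hcomp.congr hf₀ (hf₀ r hr)).congr_deriv ?_
    push_cast
    ring
  have hc_le : ∀ r ∈ Ioc (0 : ℝ) 1, c ≤ D r := fun r hr => by
    have hr' := Ioc_subset_Icc_self hr
    have := hslope r hr
    rwa [profileDeriv, (hderiv r hr').derivWithin (hunique r hr'),
      mul_div_cancel_left₀ _ hr.1.ne'] at this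
  have hclosure : closure (Ioc (0 : ℝ) 1) = Icc 0 1 := closure_Ioc zero_ne_one
  obtain ⟨M, hM⟩ := isCompact_Icc.bddAbove_image hD
  refine ⟨D, c, M, hc, hD, fun r hr => ⟨?_, hM (mem_image_of_mem D hr)⟩, hderiv⟩
  exact le_on_closure hc_le continuousOn_const (hclosure ▸ hD) (hclosure ▸ hr)

namespace HasRadialSlope

lemma continuousOn (h : HasRadialSlope f₀ D c M) : ContinuousOn f₀ (Icc 0 1) :=
  fun r hr => (h.hasDerivWithinAt r hr).continuousWithinAt

lemma profileDeriv_eq (h : HasRadialSlope f₀ D c M) (hr : r ∈ Icc (0 : ℝ) 1) :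
    profileDeriv f₀ r = r * D r :=
  (h.hasDerivWithinAt r hr).derivWithin (uniqueDiffOn_Icc zero_lt_one r hr)

lemma hasDerivAt (h : HasRadialSlope f₀ D c M) (hr : r ∈ Ioo (0 : ℝ) 1) :
    HasDerivAt f₀ (r * D r) r :=
  (h.hasDerivWithinAt r (Ioo_subset_Icc_self hr)).hasDerivAt (Icc_mem_nhds hr.1 hr.2)

lemma upper_pos (h : HasRadialSlope f₀ D c M) : 0 < M :=
  have hD := h.slope_mem 0 ⟨le_rfl, zero_le_one⟩
  h.pos.trans_le (hD.1.trans hD.2)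

lemma monotoneOn_sub_sq (h : HasRadialSlope f₀ D c M) :
    MonotoneOn (fun x => f₀ x - c / 2 * x ^ 2) (Icc 0 1) := fun x hx y hy hxy => by
  have := sub_le_sub_of_hasDerivAt_le (u := fun x => c / 2 * x ^ 2) (by fun_prop) h.continuousOn
    (fun r _ => (hasDerivAt_pow 2 r).const_mul (c / 2)) (fun r hr => h.hasDerivAt hr)
    (fun r hr => by
      have := mul_le_mul_of_nonneg_left (h.slope_mem r (Ioo_subset_Icc_self hr)).1 hr.1.le
      norm_num
      linarith) hx hy hxy
  linarith

lemma monotoneOn_sq_sub (h : HasRadialSlope f₀ D c M) :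
    MonotoneOn (fun x => M / 2 * x ^ 2 - f₀ x) (Icc 0 1) := fun x hx y hy hxy => by
  have := sub_le_sub_of_hasDerivAt_le (v := fun x => M / 2 * x ^ 2) h.continuousOn (by fun_prop)
    (fun r hr => h.hasDerivAt hr) (fun r _ => (hasDerivAt_pow 2 r).const_mul (M / 2))
    (fun r hr => by
      have := mul_le_mul_of_nonneg_left (h.slope_mem r (Ioo_subset_Icc_self hr)).2 hr.1.le
      norm_num
      linarith) hx hy hxy
  linarith

lemma monotoneOn (h : HasRadialSlope f₀ D c M) : MonotoneOn f₀ (Icc 0 1) :=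
  fun x hx y hy hxy => by
    have hc := mul_le_mul_of_nonneg_left (pow_le_pow_left₀ hx.1 hxy 2) (half_pos h.pos).le
    have hsub : f₀ x - c / 2 * x ^ 2 ≤ f₀ y - c / 2 * y ^ 2 := h.monotoneOn_sub_sq hx hy hxy
    linarith

lemma apply_zero_lt_apply_one (h : HasRadialSlope f₀ D c M) : f₀ 0 < f₀ 1 := by
  have hsub : f₀ 0 - c / 2 * 0 ^ 2 ≤ f₀ 1 - c / 2 * 1 ^ 2 := h.monotoneOn_sub_sq
    ⟨le_rfl, zero_le_one⟩ ⟨zero_le_one, le_rfl⟩ zero_le_one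
  linarith [h.pos]

lemma radialAvg_mem (h : HasRadialSlope f₀ D c M) (k : ℕ) (hr : r ∈ Icc (0 : ℝ) 1) :
    radialAvg k f₀ r ∈ Icc (f₀ 0 / (k + 1)) (f₀ r / (k + 1)) := by
  have hsub : Icc 0 r ⊆ Icc (0 : ℝ) 1 := Icc_subset_Icc_right hr.2
  have hcont := h.continuousOn.mono hsub
  exact ⟨le_radialAvg k hr.1 hcont fun x hx =>
      h.monotoneOn ⟨le_rfl, zero_le_one⟩ (hsub hx) hx.1,
    radialAvg_le k hr.1 hcont fun x hx => h.monotoneOn (hsub hx) hr hx.2⟩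

lemma radialAvg_sub_sq (h : HasRadialSlope f₀ D c M) (k : ℕ) (C : ℝ) (hr : r ∈ Icc (0 : ℝ) 1) :
    radialAvg k (fun x => f₀ x - C * x ^ 2) r = radialAvg k f₀ r - C * r ^ 2 / (k + 3) := by
  rw [radialAvg_sub k hr.1 (h.continuousOn.mono (Icc_subset_Icc_right hr.2)) (by fun_prop),
    radialAvg_const_mul_sq]

lemma le_radialAvg_increment (h : HasRadialSlope f₀ D c M) (hr : r ∈ Icc (0 : ℝ) 1) :
    c / 8 * (1 - r ^ 2) ≤ radialAvg 1 f₀ 1 - radialAvg 1 f₀ r := by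
  have hle := radialAvg_le_radialAvg_one 1 (q := fun x => f₀ x - c / 2 * x ^ 2)
    (h.continuousOn.sub (by fun_prop)) h.monotoneOn_sub_sq hr
  rw [h.radialAvg_sub_sq 1 _ hr, h.radialAvg_sub_sq 1 _ ⟨zero_le_one, le_rfl⟩] at hle
  norm_num at hle
  linarith

lemma radialAvg_increment_le (h : HasRadialSlope f₀ D c M) (hr : r ∈ Icc (0 : ℝ) 1) :
    radialAvg 1 f₀ 1 - radialAvg 1 f₀ r ≤ M / 8 * (1 - r ^ 2) := by
  have hle := radialAvg_le_radialAvg_one 1 (q := fun x => M / 2 * x ^ 2 - f₀ x)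
    (ContinuousOn.sub (by fun_prop) h.continuousOn) h.monotoneOn_sq_sub hr
  rw [radialAvg_sub 1 hr.1 (by fun_prop) (h.continuousOn.mono (Icc_subset_Icc_right hr.2)),
    radialAvg_sub 1 zero_le_one (by fun_prop) h.continuousOn, radialAvg_const_mul_sq,
    radialAvg_const_mul_sq] at hle
  norm_num at hle
  linarith

end HasRadialSlope

end Profile

section Reduction

variable {f₀ D : ℝ → ℝ} {c M Ω r : ℝ} {m : ℕ}

lemma kappa₂_eq_radialAvg (f₀ : ℝ → ℝ) : kappa₂ f₀ = radialAvg 1 f₀ 1 := by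
  simp only [kappa₂, radialAvg_at_one, pow_one]

lemma singularValue_eq_radialAvg (f₀ : ℝ → ℝ) (n : ℕ) :
    singularValue f₀ n = kappa₂ f₀ - ((n : ℝ) + 1) / n * radialAvg (2 * n + 1) f₀ 1 := by
  rw [singularValue, radialAvg_at_one]

/-- The gap `Ω - ∫₀¹ s f₀(sr) ds` between the rotation speed `Ω` and the angular velocity at radius
`r` of the flow with vorticity `f₀`: the denominator of `μ_Ω⁰`. -/
def gap (f₀ : ℝ → ℝ) (Ω r : ℝ) : ℝ := Ω - radialAvg 1 f₀ r

/-- The coefficient `μ_Ω⁰` in terms of the slope `D(r) = f₀'(r)/r`, which makes it continuous up to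
`r = 0`. -/
def sturmCoeff (f₀ D : ℝ → ℝ) (Ω r : ℝ) : ℝ := D r / gap f₀ Ω r

/-- The inhomogeneity `Ω - f₀/2` of the radial equation behind `h_m^⋆`. -/
def source (f₀ : ℝ → ℝ) (Ω r : ℝ) : ℝ := Ω - f₀ r / 2

/-- The solution `F_{m,Ω} Φ` of the radial equation with right-hand side `source f₀ Ω` that vanishes
at `r = 1`. -/
def sourceResponse (f₀ : ℝ → ℝ) (m : ℕ) (Ω r : ℝ) : ℝ :=
  sturm f₀ m Ω r * varConst (2 * m + 1) (sturm f₀ m Ω) (source f₀ Ω) r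

/-- The function `N` with `r G_m(r) - r^{m+2} G_m(1) = r^m N(r)`. It does not depend on `Ω`. -/
def gDefect (f₀ : ℝ → ℝ) (m : ℕ) (r : ℝ) : ℝ :=
  kappa₂ f₀ * (1 - r ^ 2) + (m + 1) * r ^ 2 *
    ((radialAvg 1 f₀ 1 - radialAvg 1 f₀ r)
      - (radialAvg (2 * m + 1) f₀ 1 - radialAvg (2 * m + 1) f₀ r))

/-- At a zero of `ζ_m` this is `r^{-m} d_m^⋆(r)`. -/
def transBracket (f₀ : ℝ → ℝ) (m : ℕ) (Ω r : ℝ) : ℝ :=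
  sourceResponse f₀ m Ω r / gap f₀ Ω r + 1 / (4 * (m + 1)) * (gDefect f₀ m r / Gfun f₀ m Ω 1)

/-- The weight `ν_Ω(r) r^{2m+1} F_{m,Ω}(r)` against which `transBracket` is integrated. -/
def transWeight (f₀ D : ℝ → ℝ) (m : ℕ) (Ω r : ℝ) : ℝ :=
  |sturmCoeff f₀ D Ω r| * r ^ (2 * m + 1) * sturm f₀ m Ω r

lemma Gfun_one (hm : m ≠ 0) : Gfun f₀ m Ω 1 = m * (Ω - singularValue f₀ m) := by
  simp only [Gfun, singularValue, one_pow]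
  rw [show ∫ s in (0 : ℝ)..1, s * f₀ s = kappa₂ f₀ from rfl]
  field_simp
  ring

lemma mul_Gfun_sub (hm : m ≠ 0) (hr : r ≠ 0) :
    r * Gfun f₀ m Ω r - r ^ (m + 2) * Gfun f₀ m Ω 1 = r ^ m * gDefect f₀ m r := by
  obtain ⟨n, rfl⟩ := Nat.exists_eq_succ_of_ne_zero hm
  have hlow : ∀ x, ∫ s in (0 : ℝ)..x, s * f₀ s = x ^ 2 * radialAvg 1 f₀ x := fun x => by
    simpa only [pow_one] using (pow_succ_mul_radialAvg 1 f₀ x).symm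
  have hhigh : ∀ x, ∫ s in (0 : ℝ)..x, s ^ (2 * n.succ + 1) * f₀ s
      = x ^ (2 * n.succ + 1 + 1) * radialAvg (2 * n.succ + 1) f₀ x := fun x =>
    (pow_succ_mul_radialAvg _ f₀ x).symm
  simp only [Gfun, gDefect, hlow, hhigh, kappa₂_eq_radialAvg, Nat.succ_eq_add_one,
    Nat.add_sub_cancel, one_pow]
  field_simp
  ring

lemma hStar_eq (f₀ : ℝ → ℝ) (m : ℕ) (Ω r : ℝ) :
    hStar f₀ m Ω r = r ^ m * (mu f₀ Ω r * sourceResponse f₀ m Ω r) := by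
  have hphase : ∫ s in (1 : ℝ)..r, 1 / (sturm f₀ m Ω s ^ 2 * s ^ (2 * m + 1)) *
      ∫ τ in (0 : ℝ)..s, sturm f₀ m Ω τ * τ ^ (2 * m + 1) * (Ω - f₀ τ / 2)
      = varConst (2 * m + 1) (sturm f₀ m Ω) (source f₀ Ω) r := by
    simp only [varConst, mul_radialAvg_eq_div, source, mul_comm (sturm f₀ m Ω _) (_ ^ (2 * m + 1)),
      mul_assoc]
    congr 1 with s
    ring
  rw [hStar, hphase, sourceResponse]
  ring

lemma zeta_eq (f₀ : ℝ → ℝ) (m : ℕ) (Ω : ℝ) :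
    zeta f₀ m Ω = sturm f₀ m Ω 1 * (Ω - m / (m + 1) * kappa₂ f₀)
      - 2 * ∫ r in (0 : ℝ)..1, r ^ (2 * m + 1) * (sturm f₀ m Ω r * source f₀ Ω r) := by
  rw [zeta, ← sub_neg_eq_add, ← intervalIntegral.integral_const_mul,
    ← intervalIntegral.integral_neg]
  congr 2 with r
  rw [source]
  ring

namespace HasRadialSlope

lemma continuousOn_source (h : HasRadialSlope f₀ D c M) (Ω : ℝ) :
    ContinuousOn (source f₀ Ω) (Icc 0 1) :=
  continuousOn_const.sub (h.continuousOn.div_const 2)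

lemma continuousOn_gap (h : HasRadialSlope f₀ D c M) (Ω : ℝ) :
    ContinuousOn (gap f₀ Ω) (Icc 0 1) :=
  continuousOn_const.sub (continuousOn_radialAvg 1 h.continuousOn)

lemma continuousOn_sturmCoeff (h : HasRadialSlope f₀ D c M)
    (hgap : ∀ r ∈ Icc (0 : ℝ) 1, gap f₀ Ω r ≠ 0) :
    ContinuousOn (sturmCoeff f₀ D Ω) (Icc 0 1) :=
  h.continuousOn_slope.div (h.continuousOn_gap Ω) hgap

lemma continuousOn_gDefect (h : HasRadialSlope f₀ D c M) (m : ℕ) :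
    ContinuousOn (gDefect f₀ m) (Icc 0 1) := by
  have hlow := continuousOn_radialAvg 1 h.continuousOn
  have hhigh := continuousOn_radialAvg (2 * m + 1) h.continuousOn
  unfold gDefect
  fun_prop

lemma mu_eq (h : HasRadialSlope f₀ D c M) (hr : r ∈ Ioc (0 : ℝ) 1) :
    mu f₀ Ω r = sturmCoeff f₀ D Ω r := by
  rw [mu, h.profileDeriv_eq (Ioc_subset_Icc_self hr), mul_div_mul_left _ _ hr.1.ne', sturmCoeff,
    gap, radialAvg]
  simp only [pow_one]

lemma isSturmSolution_sturm (h : HasRadialSlope f₀ D c M)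
    (hgap : ∀ r ∈ Icc (0 : ℝ) 1, gap f₀ Ω r ≠ 0) (m : ℕ) :
    IsSturmSolution f₀ m Ω (sturm f₀ m Ω) := by
  have hexists : ∃ F, IsSturmSolution f₀ m Ω F := by
    obtain ⟨F, hF, hF0, hode⟩ :=
      exists_contDiffOn_radial_solution (2 * m + 1) (h.continuousOn_sturmCoeff hgap)
    refine ⟨F, hF, hF0, fun r hr => ?_⟩
    have := hode r hr
    push_cast at this
    rwa [h.mu_eq hr]
  rw [sturm, dif_pos hexists]
  exact hexists.choose_spec

lemma isRadialSolution_sturm (h : HasRadialSlope f₀ D c M)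
    (hgap : ∀ r ∈ Icc (0 : ℝ) 1, gap f₀ Ω r ≠ 0) (m : ℕ) :
    IsRadialSolution (2 * m + 1) (sturmCoeff f₀ D Ω) (sturm f₀ m Ω) := by
  obtain ⟨hF, hF0, hode⟩ := h.isSturmSolution_sturm hgap m
  refine isRadialSolution_of_contDiffOn (Nat.succ_ne_zero _) (h.continuousOn_sturmCoeff hgap) hF hF0
    fun r hr => ?_
  have := hode r (Ioo_subset_Ioc_self hr)
  push_cast
  rwa [h.mu_eq (Ioo_subset_Ioc_self hr)] at this

lemma continuousOn_sourceResponse (h : HasRadialSlope f₀ D c M)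
    (hgap : ∀ r ∈ Icc (0 : ℝ) 1, gap f₀ Ω r ≠ 0)
    (hF0 : ∀ r ∈ Icc (0 : ℝ) 1, sturm f₀ m Ω r ≠ 0) :
    ContinuousOn (sourceResponse f₀ m Ω) (Icc 0 1) :=
  have hF := (h.isRadialSolution_sturm hgap m).continuousOn
  hF.mul (continuousOn_varConst _ hF (h.continuousOn_source Ω) hF0)

lemma continuousOn_transWeight (h : HasRadialSlope f₀ D c M)
    (hgap : ∀ r ∈ Icc (0 : ℝ) 1, gap f₀ Ω r ≠ 0) (m : ℕ) :
    ContinuousOn (transWeight f₀ D m Ω) (Icc 0 1) :=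
  ((h.continuousOn_sturmCoeff hgap).abs.mul (continuous_pow _).continuousOn).mul
    (h.isRadialSolution_sturm hgap m).continuousOn

lemma continuousOn_transBracket (h : HasRadialSlope f₀ D c M)
    (hgap : ∀ r ∈ Icc (0 : ℝ) 1, gap f₀ Ω r ≠ 0)
    (hF0 : ∀ r ∈ Icc (0 : ℝ) 1, sturm f₀ m Ω r ≠ 0) :
    ContinuousOn (transBracket f₀ m Ω) (Icc 0 1) :=
  ((h.continuousOn_sourceResponse hgap hF0).div (h.continuousOn_gap Ω) hgap).add
    (continuousOn_const.mul ((h.continuousOn_gDefect m).div_const _))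

lemma integral_pow_mul_source (h : HasRadialSlope f₀ D c M) (m : ℕ) (Ω : ℝ) :
    ∫ r in (0 : ℝ)..1, r ^ (2 * m + 1) * source f₀ Ω r
      = Ω / (2 * m + 2) - radialAvg (2 * m + 1) f₀ 1 / 2 := by
  rw [← radialAvg_at_one]
  have hsub := radialAvg_sub (2 * m + 1) zero_le_one (q := fun _ => Ω) (q' := fun x => f₀ x / 2)
    continuousOn_const (h.continuousOn.div_const 2)
  have hhalf : radialAvg (2 * m + 1) (fun x => f₀ x / 2) 1 = radialAvg (2 * m + 1) f₀ 1 / 2 := by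
    simp only [radialAvg, ← mul_div_assoc, intervalIntegral.integral_div]
  rw [radialAvg_const, hhalf] at hsub
  refine hsub.trans ?_
  push_cast
  ring

lemma Hop_hStar (h : HasRadialSlope f₀ D c M) (hm : m ≠ 0)
    (hgap : ∀ r ∈ Icc (0 : ℝ) 1, gap f₀ Ω r ≠ 0)
    (hF0 : ∀ r ∈ Icc (0 : ℝ) 1, sturm f₀ m Ω r ≠ 0) (hζ : zeta f₀ m Ω = 0) :
    Hop m (hStar f₀ m Ω) 1 = -(Gfun f₀ m Ω 1 / (2 * (m + 1))) := by
  have hHop : Hop m (hStar f₀ m Ω) 1 = ∫ r in (0 : ℝ)..1, r ^ (2 * m + 1) *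
      (sturmCoeff f₀ D Ω r * sturm f₀ m Ω r *
        varConst (2 * m + 1) (sturm f₀ m Ω) (source f₀ Ω) r) := by
    simp only [Hop, intervalIntegral.integral_same, mul_zero, zero_add]
    refine intervalIntegral.integral_congr_uIoo fun r hr => ?_
    rw [uIoo_of_le zero_le_one] at hr
    simp only [hStar_eq, h.mu_eq (Ioo_subset_Ioc_self hr), sourceResponse]
    ring
  have hprojection : (∫ r in (0 : ℝ)..1, r ^ (2 * m + 1) * (sturm f₀ m Ω r * source f₀ Ω r))
      / sturm f₀ m Ω 1 = (Ω - m / (m + 1) * kappa₂ f₀) / 2 := by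
    rw [zeta_eq] at hζ
    rw [div_eq_iff (hF0 1 ⟨zero_le_one, le_rfl⟩)]
    linarith
  rw [hHop, (h.isRadialSolution_sturm hgap m).integral_mul_varConst
    (h.continuousOn_sturmCoeff hgap) (h.continuousOn_source Ω) hF0, h.integral_pow_mul_source,
    hprojection, Gfun_one hm, singularValue_eq_radialAvg]
  field_simp
  ring

lemma Aop_hStar (h : HasRadialSlope f₀ D c M) (hm : m ≠ 0)
    (hgap : ∀ r ∈ Icc (0 : ℝ) 1, gap f₀ Ω r ≠ 0)
    (hF0 : ∀ r ∈ Icc (0 : ℝ) 1, sturm f₀ m Ω r ≠ 0) (hζ : zeta f₀ m Ω = 0)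
    (hG : Gfun f₀ m Ω 1 ≠ 0) : Aop f₀ m Ω (hStar f₀ m Ω) = 1 / (4 * (m + 1)) := by
  rw [Aop, h.Hop_hStar hm hgap hF0 hζ]
  field_simp
  norm_num

lemma dStar_eq (h : HasRadialSlope f₀ D c M) (hm : m ≠ 0)
    (hgap : ∀ r ∈ Icc (0 : ℝ) 1, gap f₀ Ω r ≠ 0)
    (hF0 : ∀ r ∈ Icc (0 : ℝ) 1, sturm f₀ m Ω r ≠ 0) (hζ : zeta f₀ m Ω = 0)
    (hG : Gfun f₀ m Ω 1 ≠ 0) (hr : r ∈ Ioc (0 : ℝ) 1) :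
    dStar f₀ m Ω r = r ^ m * transBracket f₀ m Ω r := by
  have hr' := Ioc_subset_Icc_self hr
  have hr0 := hr.1.ne'
  have hD : D r ≠ 0 := (h.pos.trans_le (h.slope_mem r hr').1).ne'
  have hgap_r := hgap r hr'
  have hresponse : mu f₀ Ω r * (r / profileDeriv f₀ r) = 1 / gap f₀ Ω r := by
    rw [h.mu_eq hr, h.profileDeriv_eq hr', sturmCoeff]
    field_simp
  calc dStar f₀ m Ω r
      = r ^ m * sourceResponse f₀ m Ω r * (mu f₀ Ω r * (r / profileDeriv f₀ r))
        + 1 / (4 * (m + 1)) *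
          ((r * Gfun f₀ m Ω r - r ^ (m + 2) * Gfun f₀ m Ω 1) / Gfun f₀ m Ω 1) := by
        rw [dStar, h.Aop_hStar hm hgap hF0 hζ hG, hStar_eq]
        field_simp
        ring
    _ = r ^ m * transBracket f₀ m Ω r := by
        rw [hresponse, mul_Gfun_sub hm hr0, transBracket]
        ring

theorem transInt_eq (h : HasRadialSlope f₀ D c M) (hm : m ≠ 0)
    (hgap : ∀ r ∈ Icc (0 : ℝ) 1, gap f₀ Ω r ≠ 0)
    (hF0 : ∀ r ∈ Icc (0 : ℝ) 1, sturm f₀ m Ω r ≠ 0) (hζ : zeta f₀ m Ω = 0)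
    (hG : Gfun f₀ m Ω 1 ≠ 0) :
    transInt f₀ m Ω = ∫ r in (0 : ℝ)..1, transWeight f₀ D m Ω r * transBracket f₀ m Ω r := by
  refine intervalIntegral.integral_congr_uIoo fun r hr => ?_
  rw [uIoo_of_le zero_le_one] at hr
  have hr' := Ioo_subset_Ioc_self hr
  simp only [nu, h.mu_eq hr', h.dStar_eq hm hgap hF0 hζ hG hr', transWeight]
  ring

lemma le_gDefect (h : HasRadialSlope f₀ D c M) (hm : m ≠ 0) (hr : r ∈ Icc (0 : ℝ) 1) :
    (1 - r ^ 2) * (kappa₂ f₀ + c / 12 * m * r ^ 2) ≤ gDefect f₀ m r := by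
  have h1 : (1 : ℝ) ∈ Icc (0 : ℝ) 1 := ⟨zero_le_one, le_rfl⟩
  have hm1 : (1 : ℝ) ≤ m := by exact_mod_cast Nat.one_le_iff_ne_zero.2 hm
  have hsq : 0 ≤ r ^ 2 * (1 - r ^ 2) :=
    mul_nonneg (sq_nonneg r) (sub_nonneg.2 (pow_le_one₀ hr.1 hr.2))
  have hincr := radialAvg_increment_antitone (j := 1) (k := 2 * m + 1)
    (q := fun x => f₀ x - c / 2 * x ^ 2) (by omega) (h.continuousOn.sub (by fun_prop))
    h.monotoneOn_sub_sq hr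
  simp only [h.radialAvg_sub_sq _ _ hr, h.radialAvg_sub_sq _ _ h1] at hincr
  have hcoef : c / 12 * m ≤ (m + 1) * (c / 2 * (1 / 4 - 1 / (2 * m + 4))) := by
    have : (m + 1) * (c / 2 * (1 / 4 - 1 / (2 * m + 4))) - c / 12 * m
        = c * m * (m - 1) / (24 * ((m : ℝ) + 2)) := by
      field_simp
      ring
    have := h.pos
    have : 0 ≤ c * m * (m - 1) / (24 * ((m : ℝ) + 2)) :=
      div_nonneg (mul_nonneg (by positivity) (sub_nonneg.2 hm1)) (by positivity)
    linarith
  have hscaled := mul_le_mul_of_nonneg_left hincr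
    (by positivity : (0 : ℝ) ≤ (m + 1) * r ^ 2)
  have hgain := mul_le_mul_of_nonneg_right hcoef hsq
  have hden : (((2 * m + 1 : ℕ) : ℝ) + 3) = 2 * m + 4 := by push_cast; ring
  rw [hden] at hscaled
  rw [gDefect]
  norm_num at hscaled
  linear_combination hscaled + hgain

end HasRadialSlope

end Reduction

section PositiveProfile

variable {f₀ D : ℝ → ℝ} {c M Ω r : ℝ} {m : ℕ}

namespace HasRadialSlope

lemma kappa₂_mem (h : HasRadialSlope f₀ D c M) : kappa₂ f₀ ∈ Icc (f₀ 0 / 2) (f₀ 1 / 2) := by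
  have := h.radialAvg_mem 1 ⟨zero_le_one, le_rfl⟩
  rw [kappa₂_eq_radialAvg]
  norm_num at this
  exact this

lemma gap_le (h : HasRadialSlope f₀ D c M) (hr : r ∈ Icc (0 : ℝ) 1) :
    gap f₀ Ω r ≤ -(f₀ 0 / 2 - Ω) := by
  have := (h.radialAvg_mem 1 hr).1
  rw [gap]
  norm_num at this
  linarith

lemma sub_lt_offset (h : HasRadialSlope f₀ D c M) (hpos : 0 < f₀ 0) (hm : m ≠ 0)
    (hflat : 10 * m * (f₀ 1 - f₀ 0) ≤ f₀ 0) (hΩ : Ω < m * kappa₂ f₀ / (m + 1)) :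
    f₀ 1 - f₀ 0 < f₀ 0 / 2 - Ω := by
  have hm1 : (1 : ℝ) ≤ m := by exact_mod_cast Nat.one_le_iff_ne_zero.2 hm
  have hm0 : (0 : ℝ) < m + 1 := by linarith
  have hκ := mul_le_mul_of_nonneg_left h.kappa₂_mem.2 m.cast_nonneg
  have hjump := mul_le_mul_of_nonneg_right hm1 (sub_nonneg.2 h.apply_zero_lt_apply_one.le)
  rw [lt_div_iff₀ hm0] at hΩ
  refine lt_of_mul_lt_mul_left ?_ hm0.le
  linarith

lemma abs_source_le (h : HasRadialSlope f₀ D c M) (hoffset : f₀ 1 - f₀ 0 < f₀ 0 / 2 - Ω)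
    (hr : r ∈ Icc (0 : ℝ) 1) : |source f₀ Ω r| ≤ 3 / 2 * (f₀ 0 / 2 - Ω) := by
  have hlo := h.monotoneOn ⟨le_rfl, zero_le_one⟩ hr hr.1
  have hhi := h.monotoneOn hr ⟨zero_le_one, le_rfl⟩ hr.2
  rw [source, abs_le]
  constructor <;> linarith

lemma Gfun_one_lt (h : HasRadialSlope f₀ D c M) (hm : m ≠ 0)
    (hflat : 10 * m * (f₀ 1 - f₀ 0) ≤ f₀ 0) (hΩ : Ω < m * kappa₂ f₀ / (m + 1))
    (hG : 0 < Gfun f₀ m Ω 1) : 3 / 2 * Gfun f₀ m Ω 1 < kappa₂ f₀ := by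
  have hm1 : (1 : ℝ) ≤ m := by exact_mod_cast Nat.one_le_iff_ne_zero.2 hm
  have hm0 : (0 : ℝ) < m + 1 := by linarith
  have hκ := h.kappa₂_mem.1
  have hmκ := mul_le_mul_of_nonneg_left hκ m.cast_nonneg
  have hjump := mul_le_mul_of_nonneg_right hm1 (sub_nonneg.2 h.apply_zero_lt_apply_one.le)
  have havg := (h.radialAvg_mem (2 * m + 1) ⟨zero_le_one, le_rfl⟩).2
  have hhigh : (m + 1) * radialAvg (2 * m + 1) f₀ 1 ≤ f₀ 1 / 2 := by
    refine (mul_le_mul_of_nonneg_left havg hm0.le).trans_eq ?_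
    push_cast
    field_simp
    ring
  have hG_eq : Gfun f₀ m Ω 1 = m * Ω - m * kappa₂ f₀ + (m + 1) * radialAvg (2 * m + 1) f₀ 1 := by
    rw [Gfun_one hm, singularValue_eq_radialAvg]
    field_simp
    ring
  rw [lt_div_iff₀ hm0] at hΩ
  have hscaled : (m + 1) * Gfun f₀ m Ω 1 ≤ 3 / 5 * f₀ 0 := by
    have hmΩ := mul_le_mul_of_nonneg_left hΩ.le m.cast_nonneg
    have hhigh' := mul_le_mul_of_nonneg_left hhigh hm0.le
    rw [hG_eq]
    linarith
  linarith [mul_le_mul_of_nonneg_right hm1 hG.le]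

lemma gap_neg (h : HasRadialSlope f₀ D c M) (hoffset : f₀ 1 - f₀ 0 < f₀ 0 / 2 - Ω) :
    ∀ r ∈ Icc (0 : ℝ) 1, gap f₀ Ω r < 0 := fun r hr => by
  linarith [h.gap_le (Ω := Ω) hr, h.apply_zero_lt_apply_one]

lemma sturmCoeff_neg (h : HasRadialSlope f₀ D c M) (hgap : ∀ r ∈ Icc (0 : ℝ) 1, gap f₀ Ω r < 0) :
    ∀ r ∈ Icc (0 : ℝ) 1, sturmCoeff f₀ D Ω r < 0 := fun r hr =>
  div_neg_of_pos_of_neg (h.pos.trans_le (h.slope_mem r hr).1) (hgap r hr)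

lemma one_le_sturm (h : HasRadialSlope f₀ D c M) (hgap : ∀ r ∈ Icc (0 : ℝ) 1, gap f₀ Ω r < 0)
    (m : ℕ) (hr : r ∈ Icc (0 : ℝ) 1) : 1 ≤ sturm f₀ m Ω r :=
  have hgap0 : ∀ r ∈ Icc (0 : ℝ) 1, gap f₀ Ω r ≠ 0 := fun r hr => (hgap r hr).ne
  (h.isRadialSolution_sturm hgap0 m).one_le (h.continuousOn_sturmCoeff hgap0)
    (fun r hr => (h.sturmCoeff_neg hgap r hr).le) hr

lemma abs_sourceResponse_div_gap_le (h : HasRadialSlope f₀ D c M)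
    (hoffset : f₀ 1 - f₀ 0 < f₀ 0 / 2 - Ω) (m : ℕ) (hr : r ∈ Icc (0 : ℝ) 1) :
    |sourceResponse f₀ m Ω r / gap f₀ Ω r| ≤ 3 / (8 * (m + 1)) * (1 - r ^ 2) := by
  have hgap := h.gap_neg hoffset
  have hgap0 : ∀ r ∈ Icc (0 : ℝ) 1, gap f₀ Ω r ≠ 0 := fun r hr => (hgap r hr).ne
  have hF := h.isRadialSolution_sturm hgap0 m
  have hpos : ∀ r ∈ Icc (0 : ℝ) 1, 0 < sturm f₀ m Ω r := fun r hr =>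
    zero_lt_one.trans_le (h.one_le_sturm hgap m hr)
  have hmono := hF.monotoneOn (h.continuousOn_sturmCoeff hgap0)
    fun r hr => (h.sturmCoeff_neg hgap r hr).le
  have hsq : 0 ≤ 1 - r ^ 2 := sub_nonneg.2 (pow_le_one₀ hr.1 hr.2)
  have hresponse : |sourceResponse f₀ m Ω r|
      ≤ 3 / 2 * (f₀ 0 / 2 - Ω) / (2 * ((2 * m + 1 : ℕ) + 1)) * (1 - r ^ 2) := by
    rw [sourceResponse, abs_mul, abs_of_pos (hpos r hr)]
    exact mul_abs_varConst_le_of_monotoneOn hF.continuousOn hmono hpos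
      (h.continuousOn_source Ω) (fun _ hs => h.abs_source_le hoffset hs) hr
  rw [abs_div, abs_of_neg (hgap r hr), div_le_iff₀ (neg_pos.2 (hgap r hr))]
  calc |sourceResponse f₀ m Ω r|
      ≤ 3 / 2 * (f₀ 0 / 2 - Ω) / (2 * ((2 * m + 1 : ℕ) + 1)) * (1 - r ^ 2) := hresponse
    _ = 3 / (8 * (m + 1)) * (1 - r ^ 2) * (f₀ 0 / 2 - Ω) := by
        push_cast
        field_simp
        ring
    _ ≤ 3 / (8 * (m + 1)) * (1 - r ^ 2) * -gap f₀ Ω r :=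
        mul_le_mul_of_nonneg_left (le_neg_of_le_neg (h.gap_le hr)) (by positivity)

lemma transBracket_pos (h : HasRadialSlope f₀ D c M) (hm : m ≠ 0)
    (hoffset : f₀ 1 - f₀ 0 < f₀ 0 / 2 - Ω) (hG : 0 < Gfun f₀ m Ω 1)
    (hGκ : 3 / 2 * Gfun f₀ m Ω 1 < kappa₂ f₀) (hr : r ∈ Ico (0 : ℝ) 1) :
    0 < transBracket f₀ m Ω r := by
  have hr' := Ico_subset_Icc_self hr
  have hsq : 0 < 1 - r ^ 2 := sub_pos.2 (pow_lt_one₀ hr.1 hr.2 two_ne_zero)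
  have hdefect : (1 - r ^ 2) * (3 / 2) < gDefect f₀ m r / Gfun f₀ m Ω 1 := by
    rw [lt_div_iff₀ hG]
    have hcm : 0 ≤ c / 12 * m * r ^ 2 := by have := h.pos; positivity
    calc (1 - r ^ 2) * (3 / 2) * Gfun f₀ m Ω 1 = (1 - r ^ 2) * (3 / 2 * Gfun f₀ m Ω 1) := by ring
      _ < (1 - r ^ 2) * (kappa₂ f₀ + c / 12 * m * r ^ 2) :=
          mul_lt_mul_of_pos_left (by linarith) hsq
      _ ≤ gDefect f₀ m r := h.le_gDefect hm hr'
  have hresponse := (abs_le.1 (h.abs_sourceResponse_div_gap_le hoffset m hr')).1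
  calc (0 : ℝ) = -(3 / (8 * (m + 1)) * (1 - r ^ 2))
        + 1 / (4 * (m + 1)) * ((1 - r ^ 2) * (3 / 2)) := by
        field_simp
        ring
    _ < transBracket f₀ m Ω r := by
        exact add_lt_add_of_le_of_lt hresponse (mul_lt_mul_of_pos_left hdefect (by positivity))

theorem transInt_pos (h : HasRadialSlope f₀ D c M) (hpos : 0 < f₀ 0) (hm : m ≠ 0)
    (hflat : 10 * m * (f₀ 1 - f₀ 0) ≤ f₀ 0)
    (hΩ : Ω ∈ Ioo (singularValue f₀ m) (m * kappa₂ f₀ / (m + 1))) (hζ : zeta f₀ m Ω = 0) :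
    0 < transInt f₀ m Ω := by
  have hoffset := h.sub_lt_offset hpos hm hflat hΩ.2
  have hG : 0 < Gfun f₀ m Ω 1 := by
    rw [Gfun_one hm]
    exact mul_pos (by positivity) (sub_pos.2 hΩ.1)
  have hgap := h.gap_neg hoffset
  have hgap0 : ∀ r ∈ Icc (0 : ℝ) 1, gap f₀ Ω r ≠ 0 := fun r hr => (hgap r hr).ne
  have hF : ∀ r ∈ Icc (0 : ℝ) 1, 0 < sturm f₀ m Ω r := fun r hr =>
    zero_lt_one.trans_le (h.one_le_sturm hgap m hr)
  have hF0 : ∀ r ∈ Icc (0 : ℝ) 1, sturm f₀ m Ω r ≠ 0 := fun r hr => (hF r hr).ne'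
  rw [h.transInt_eq hm hgap0 hF0 hζ hG.ne']
  refine intervalIntegral.intervalIntegral_pos_of_pos_on
    (ContinuousOn.intervalIntegrable_of_Icc zero_le_one
      ((h.continuousOn_transWeight hgap0 m).mul (h.continuousOn_transBracket hgap0 hF0)))
    (fun r hr => mul_pos ?_ (h.transBracket_pos hm hoffset hG
      (h.Gfun_one_lt hm hflat hΩ.2 hG) (Ioo_subset_Ico_self hr))) zero_lt_one
  have hr' := Ioo_subset_Icc_self hr
  exact mul_pos (mul_pos (abs_pos.2 (h.sturmCoeff_neg hgap r hr').ne) (pow_pos hr.1 _)) (hF r hr')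

end HasRadialSlope

end PositiveProfile

section BoundaryLayer

variable {f₀ D : ℝ → ℝ} {c M Ω r δ lo hi B : ℝ} {m : ℕ}

/-- The boundary layer regime: the gap is comparable to `δ + 1 - r²`, so `μ_Ω⁰` is large, of size
`1/δ`, only within distance of order `δ` from `r = 1`. -/
structure HasLayerGap (f₀ : ℝ → ℝ) (Ω δ lo hi : ℝ) : Prop where
  width_pos : 0 < δ
  lower_pos : 0 < lo
  gap_mem : ∀ r ∈ Icc (0 : ℝ) 1, gap f₀ Ω r ∈ Icc (lo * (δ + 1 - r ^ 2)) (hi * (δ + 1 - r ^ 2))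

lemma layer_width_pos (hm : m ≠ 0) (hr : r ∈ Icc (0 : ℝ) 1) : 0 < 1 / (m : ℝ) + 1 - r ^ 2 := by
  have hm0 : (0 : ℝ) < m := by exact_mod_cast Nat.pos_of_ne_zero hm
  linarith [pow_le_one₀ (n := 2) hr.1 hr.2, one_div_pos.2 hm0]

/-- With `x = m(1-r²)`, this is the tangent line bound `1/(1+x) ≥ (5-x)/9` at `x = 2`. -/
lemma le_layer_kernel (hm : m ≠ 0) (hr : r ∈ Icc (0 : ℝ) 1) :
    m * (1 - r ^ 2) * (m * (5 - m * (1 - r ^ 2)) / 9) ≤ m * (1 - r ^ 2) / (1 / m + 1 - r ^ 2) := by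
  have hsq : 0 ≤ 1 - r ^ 2 := sub_nonneg.2 (pow_le_one₀ hr.1 hr.2)
  rw [div_eq_mul_one_div (_ * _) (1 / (m : ℝ) + 1 - r ^ 2)]
  refine mul_le_mul_of_nonneg_left ?_ (by positivity)
  rw [le_div_iff₀ (layer_width_pos hm hr)]
  calc m * (5 - m * (1 - r ^ 2)) / 9 * (1 / m + 1 - r ^ 2)
      = 1 - (m * (1 - r ^ 2) - 2) ^ 2 / 9 := by
        field_simp
        ring
    _ ≤ 1 := sub_le_self _ (by positivity)

lemma integral_layer_minorant (m : ℕ) :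
    ∫ r in (0 : ℝ)..1, r ^ (2 * m + 3) * (m * (1 - r ^ 2) * (m * (5 - m * (1 - r ^ 2)) / 9))
      = (m : ℝ) ^ 2 * (3 * m + 20) / (18 * (m + 2) * (m + 3) * (m + 4)) := by
  have hint : ∀ (n : ℕ) (C : ℝ), IntervalIntegrable (fun r : ℝ => r ^ n * C)
      volume 0 1 := fun n C => Continuous.intervalIntegrable (by fun_prop) _ _
  calc _ = ∫ r in (0 : ℝ)..1, (r ^ (2 * m + 3) * ((m : ℝ) * m * (5 - m) / 9)
        + r ^ (2 * m + 5) * ((m : ℝ) * m * (2 * m - 5) / 9)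
        - r ^ (2 * m + 7) * ((m : ℝ) ^ 3 / 9)) :=
        intervalIntegral.integral_congr fun r _ => by ring
    _ = _ := by
        rw [intervalIntegral.integral_sub ((hint _ _).add (hint _ _)) (hint _ _),
          intervalIntegral.integral_add (hint _ _) (hint _ _)]
        simp only [intervalIntegral.integral_mul_const, integral_pow]
        push_cast
        simp only [one_pow, zero_pow (Nat.succ_ne_zero _), sub_zero]
        field_simp
        ring

lemma continuousOn_layer_kernel (hm : m ≠ 0) : ContinuousOn
    (fun r : ℝ => r ^ (2 * m + 3) * (m * (1 - r ^ 2) / (1 / m + 1 - r ^ 2))) (Icc 0 1) :=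
  ContinuousOn.mul (by fun_prop)
    (ContinuousOn.div (by fun_prop) (by fun_prop) fun _ hr => (layer_width_pos hm hr).ne')

lemma le_integral_layer_kernel (hm : m ≠ 0) :
    1 / 72 ≤ ∫ r in (0 : ℝ)..1, r ^ (2 * m + 3) * (m * (1 - r ^ 2) / (1 / m + 1 - r ^ 2)) := by
  have hm1 : (1 : ℝ) ≤ m := by exact_mod_cast Nat.one_le_iff_ne_zero.2 hm
  calc (1 : ℝ) / 72 ≤ (m : ℝ) ^ 2 * (3 * m + 20) / (18 * (m + 2) * (m + 3) * (m + 4)) := by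
        rw [div_le_div_iff₀ (by norm_num) (by positivity)]
        nlinarith [mul_nonneg (sub_nonneg.2 hm1) (sq_nonneg (m : ℝ)), sub_nonneg.2 hm1]
    _ = _ := (integral_layer_minorant m).symm
    _ ≤ _ := intervalIntegral.integral_mono_on zero_le_one
        (Continuous.intervalIntegrable (by fun_prop) _ _)
        ((continuousOn_layer_kernel hm).intervalIntegrable_of_Icc zero_le_one)
        fun r hr => mul_le_mul_of_nonneg_left (le_layer_kernel hm hr) (pow_nonneg hr.1 _)

namespace HasLayerGap

lemma den_pos (hgap : HasLayerGap f₀ Ω δ lo hi) (hr : r ∈ Icc (0 : ℝ) 1) : 0 < δ + 1 - r ^ 2 := by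
  linarith [hgap.width_pos, pow_le_one₀ (n := 2) hr.1 hr.2]

lemma gap_pos (hgap : HasLayerGap f₀ Ω δ lo hi) (hr : r ∈ Icc (0 : ℝ) 1) : 0 < gap f₀ Ω r :=
  (mul_pos hgap.lower_pos (hgap.den_pos hr)).trans_le (hgap.gap_mem r hr).1

lemma gap_ne_zero (hgap : HasLayerGap f₀ Ω δ lo hi) : ∀ r ∈ Icc (0 : ℝ) 1, gap f₀ Ω r ≠ 0 :=
  fun _ hr => (hgap.gap_pos hr).ne'

lemma upper_pos (hgap : HasLayerGap f₀ Ω δ lo hi) : 0 < hi := by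
  have h0 : (0 : ℝ) ∈ Icc (0 : ℝ) 1 := ⟨le_rfl, zero_le_one⟩
  exact pos_of_mul_pos_left ((hgap.gap_pos h0).trans_le (hgap.gap_mem 0 h0).2) (hgap.den_pos h0).le

lemma sturmCoeff_mem (hgap : HasLayerGap f₀ Ω δ lo hi) (h : HasRadialSlope f₀ D c M)
    (hr : r ∈ Icc (0 : ℝ) 1) : sturmCoeff f₀ D Ω r ∈
      Icc (c / hi / (δ + 1 - r ^ 2)) (M / lo / (δ + 1 - r ^ 2)) := by
  have hD := h.slope_mem r hr
  have hbound := hgap.gap_mem r hr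
  rw [div_div, div_div]
  exact ⟨div_le_div₀ (h.pos.le.trans hD.1) hD.1 (hgap.gap_pos hr) hbound.2,
    div_le_div₀ h.upper_pos.le hD.2 (mul_pos hgap.lower_pos (hgap.den_pos hr)) hbound.1⟩

lemma sturmCoeff_pos (hgap : HasLayerGap f₀ Ω δ lo hi) (h : HasRadialSlope f₀ D c M)
    (hr : r ∈ Icc (0 : ℝ) 1) : 0 < sturmCoeff f₀ D Ω r :=
  div_pos (h.pos.trans_le (h.slope_mem r hr).1) (hgap.gap_pos hr)

lemma abs_sturm_sub_one_le (hgap : HasLayerGap f₀ Ω δ lo hi) (h : HasRadialSlope f₀ D c M)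
    (hsmall : M / lo * Real.log (1 + 1 / δ) ≤ m + 1) :
    ∀ r ∈ Icc (0 : ℝ) 1, |sturm f₀ m Ω r - 1| ≤ 1 / 3 := fun r hr =>
  (h.isRadialSolution_sturm hgap.gap_ne_zero m).abs_sub_one_le
    (h.continuousOn_sturmCoeff hgap.gap_ne_zero) (div_pos h.upper_pos hgap.lower_pos).le
    hgap.width_pos (fun s hs => by
      rw [abs_of_pos (hgap.sturmCoeff_pos h hs)]
      exact (hgap.sturmCoeff_mem h hs).2)
    (hsmall.trans_eq (by push_cast; ring)) hr

lemma transWeight_mem (hgap : HasLayerGap f₀ Ω δ lo hi) (h : HasRadialSlope f₀ D c M)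
    (hF : ∀ r ∈ Icc (0 : ℝ) 1, |sturm f₀ m Ω r - 1| ≤ 1 / 3) (hr : r ∈ Icc (0 : ℝ) 1) :
    transWeight f₀ D m Ω r ∈ Icc (2 / 3 * (c / hi) * (r ^ (2 * m + 1) / (δ + 1 - r ^ 2)))
      (4 / 3 * (M / lo) * (r ^ (2 * m + 1) / (δ + 1 - r ^ 2))) := by
  have hF' := abs_le.1 (hF r hr)
  have hμ := hgap.sturmCoeff_mem h hr
  have hμ0 := hgap.sturmCoeff_pos h hr
  have hpow : 0 ≤ r ^ (2 * m + 1) := pow_nonneg hr.1 _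
  rw [transWeight, abs_of_pos hμ0]
  constructor
  · calc 2 / 3 * (c / hi) * (r ^ (2 * m + 1) / (δ + 1 - r ^ 2))
        = c / hi / (δ + 1 - r ^ 2) * r ^ (2 * m + 1) * (2 / 3) := by ring
      _ ≤ sturmCoeff f₀ D Ω r * r ^ (2 * m + 1) * sturm f₀ m Ω r :=
        mul_le_mul (mul_le_mul_of_nonneg_right hμ.1 hpow) (by linarith) (by norm_num)
          (mul_nonneg hμ0.le hpow)
  · calc sturmCoeff f₀ D Ω r * r ^ (2 * m + 1) * sturm f₀ m Ω r
        ≤ M / lo / (δ + 1 - r ^ 2) * r ^ (2 * m + 1) * (4 / 3) :=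
        mul_le_mul (mul_le_mul_of_nonneg_right hμ.2 hpow) (by linarith) (by linarith)
          (mul_nonneg (hμ0.le.trans hμ.2) hpow)
      _ = 4 / 3 * (M / lo) * (r ^ (2 * m + 1) / (δ + 1 - r ^ 2)) := by ring

lemma abs_sourceResponse_div_gap_le (hgap : HasLayerGap f₀ Ω δ lo hi)
    (h : HasRadialSlope f₀ D c M) (hF : ∀ r ∈ Icc (0 : ℝ) 1, |sturm f₀ m Ω r - 1| ≤ 1 / 3)
    (hB : ∀ r ∈ Icc (0 : ℝ) 1, |source f₀ Ω r| ≤ B) (hr : r ∈ Icc (0 : ℝ) 1) :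
    |sourceResponse f₀ m Ω r / gap f₀ Ω r| ≤ B / ((m + 1) * lo) := by
  have hB0 : 0 ≤ B := (abs_nonneg _).trans (hB r hr)
  have hlo := hgap.lower_pos
  have hresponse : |sourceResponse f₀ m Ω r| ≤ 2 * B / ((2 * m + 1 : ℕ) + 1) * (1 - r ^ 2) := by
    rw [sourceResponse, abs_mul, abs_of_pos (by linarith [(abs_le.1 (hF r hr)).1])]
    exact mul_abs_varConst_le_of_abs_sub_one_le
      (h.isRadialSolution_sturm hgap.gap_ne_zero m).continuousOn hF (h.continuousOn_source Ω) hB hr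
  rw [abs_div, abs_of_pos (hgap.gap_pos hr), div_le_iff₀ (hgap.gap_pos hr)]
  calc |sourceResponse f₀ m Ω r| ≤ 2 * B / ((2 * m + 1 : ℕ) + 1) * (1 - r ^ 2) := hresponse
    _ = B / ((m + 1) * lo) * (lo * (1 - r ^ 2)) := by
        push_cast
        field_simp
        ring
    _ ≤ B / ((m + 1) * lo) * gap f₀ Ω r := by
        refine mul_le_mul_of_nonneg_left (le_trans ?_ (hgap.gap_mem r hr).1) (by positivity)
        exact mul_le_mul_of_nonneg_left (by linarith [hgap.width_pos]) hlo.le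

lemma abs_transWeight_mul_response_le (hgap : HasLayerGap f₀ Ω (1 / m) lo hi)
    (h : HasRadialSlope f₀ D c M) (hF : ∀ r ∈ Icc (0 : ℝ) 1, |sturm f₀ m Ω r - 1| ≤ 1 / 3)
    (hB : ∀ r ∈ Icc (0 : ℝ) 1, |source f₀ Ω r| ≤ B) (hr : r ∈ Icc (0 : ℝ) 1) :
    |transWeight f₀ D m Ω r * (sourceResponse f₀ m Ω r / gap f₀ Ω r)|
      ≤ r ^ (2 * m + 1) * (4 / 3 * (M / lo) * m * (B / ((m + 1) * lo))) := by
  have hm0 : (0 : ℝ) < m := one_div_pos.1 hgap.width_pos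
  have hlo := hgap.lower_pos
  have hM := h.upper_pos
  have hr0 := hr.1
  have hweight := hgap.transWeight_mem h hF hr
  have hden := hgap.den_pos hr
  have hweight0 : 0 ≤ transWeight f₀ D m Ω r := by
    have := h.pos
    have := hgap.upper_pos
    exact le_trans (by positivity) hweight.1
  have hpeak : r ^ (2 * m + 1) / (1 / m + 1 - r ^ 2) ≤ r ^ (2 * m + 1) * m := by
    rw [div_le_iff₀ hden, mul_assoc]
    refine le_mul_of_one_le_right (pow_nonneg hr0 _) ?_
    calc (1 : ℝ) = m * (1 / m) := by field_simp
      _ ≤ m * (1 / m + 1 - r ^ 2) := mul_le_mul_of_nonneg_left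
          (by linarith [pow_le_one₀ (n := 2) hr0 hr.2]) hm0.le
  rw [abs_mul, abs_of_nonneg hweight0]
  calc _ ≤ 4 / 3 * (M / lo) * (r ^ (2 * m + 1) * m) * (B / ((m + 1) * lo)) :=
        mul_le_mul (hweight.2.trans (mul_le_mul_of_nonneg_left hpeak (by positivity)))
          (hgap.abs_sourceResponse_div_gap_le h hF hB hr) (abs_nonneg _) (by positivity)
    _ = _ := by ring

lemma abs_integral_transWeight_mul_response_le (hgap : HasLayerGap f₀ Ω (1 / m) lo hi)
    (h : HasRadialSlope f₀ D c M) (hF : ∀ r ∈ Icc (0 : ℝ) 1, |sturm f₀ m Ω r - 1| ≤ 1 / 3)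
    (hB : ∀ r ∈ Icc (0 : ℝ) 1, |source f₀ Ω r| ≤ B) :
    4 * (m + 1) * |∫ r in (0 : ℝ)..1,
      transWeight f₀ D m Ω r * (sourceResponse f₀ m Ω r / gap f₀ Ω r)|
        ≤ 8 / 3 * (M / lo) * (B / lo) := by
  have hm0 : (0 : ℝ) < m := one_div_pos.1 hgap.width_pos
  have hlo := hgap.lower_pos
  have hM := h.upper_pos
  have hB0 : 0 ≤ B := (abs_nonneg _).trans (hB 0 ⟨le_rfl, zero_le_one⟩)
  have hint : IntervalIntegrable (fun r : ℝ =>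
      r ^ (2 * m + 1) * (4 / 3 * (M / lo) * m * (B / ((m + 1) * lo)))) volume 0 1 :=
    Continuous.intervalIntegrable (by fun_prop) _ _
  have hnorm := intervalIntegral.norm_integral_le_of_norm_le zero_le_one
    (Filter.Eventually.of_forall fun r hr => (Real.norm_eq_abs _).trans_le
      (hgap.abs_transWeight_mul_response_le h hF hB (Ioc_subset_Icc_self hr))) hint
  rw [intervalIntegral.integral_mul_const, integral_pow, Real.norm_eq_abs] at hnorm
  calc _ ≤ _ := mul_le_mul_of_nonneg_left hnorm (by positivity)
    _ = 8 / 3 * (M / lo) * (B / lo) * (m / (m + 1)) := by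
        push_cast
        simp only [one_pow, zero_pow (Nat.succ_ne_zero _), sub_zero]
        field_simp
        ring
    _ ≤ 8 / 3 * (M / lo) * (B / lo) :=
        mul_le_of_le_one_right (by positivity) ((div_le_one (by positivity)).2 (by linarith))

lemma le_transWeight_mul_gDefect (hgap : HasLayerGap f₀ Ω δ lo hi)
    (h : HasRadialSlope f₀ D c M) (hF : ∀ r ∈ Icc (0 : ℝ) 1, |sturm f₀ m Ω r - 1| ≤ 1 / 3)
    (hm : m ≠ 0) (hr : r ∈ Icc (0 : ℝ) 1) :
    c ^ 2 / (18 * hi) * (r ^ (2 * m + 3) * (m * (1 - r ^ 2) / (δ + 1 - r ^ 2)))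
      - 4 / 3 * (M / lo) * |kappa₂ f₀| * r ^ (2 * m + 1)
        ≤ transWeight f₀ D m Ω r * gDefect f₀ m r := by
  have hweight := hgap.transWeight_mem h hF hr
  have hden := hgap.den_pos hr
  have hc := h.pos
  have hhi := hgap.upper_pos
  have hr0 := hr.1
  have hsq : 0 ≤ 1 - r ^ 2 := sub_nonneg.2 (pow_le_one₀ hr.1 hr.2)
  have hlower : 0 ≤ 2 / 3 * (c / hi) * (r ^ (2 * m + 1) / (δ + 1 - r ^ 2)) := by positivity
  have hmain : c ^ 2 / (18 * hi) * (r ^ (2 * m + 3) * (m * (1 - r ^ 2) / (δ + 1 - r ^ 2)))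
      ≤ transWeight f₀ D m Ω r * ((1 - r ^ 2) * (c / 12 * m * r ^ 2)) := by
    refine le_trans (le_of_eq ?_) (mul_le_mul_of_nonneg_right hweight.1 (by positivity))
    field_simp
    ring
  have hkappa : transWeight f₀ D m Ω r * ((1 - r ^ 2) * |kappa₂ f₀|)
      ≤ 4 / 3 * (M / lo) * |kappa₂ f₀| * r ^ (2 * m + 1) := by
    have hfrac : (1 - r ^ 2) / (δ + 1 - r ^ 2) ≤ 1 :=
      (div_le_one hden).2 (by linarith [hgap.width_pos])
    have hM := h.upper_pos
    have hlo := hgap.lower_pos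
    calc _ ≤ _ := mul_le_mul_of_nonneg_right hweight.2 (by positivity)
      _ = 4 / 3 * (M / lo) * |kappa₂ f₀| * r ^ (2 * m + 1) * ((1 - r ^ 2) / (δ + 1 - r ^ 2)) := by
          ring
      _ ≤ _ := mul_le_of_le_one_right (by positivity) hfrac
  have hweight0 := hlower.trans hweight.1
  have hdefect := mul_le_mul_of_nonneg_left (h.le_gDefect hm hr) hweight0
  have hsign := mul_le_mul_of_nonneg_left (neg_abs_le (kappa₂ f₀)) (mul_nonneg hweight0 hsq)
  linarith

lemma le_integral_transWeight_mul_gDefect (hgap : HasLayerGap f₀ Ω (1 / m) lo hi)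
    (h : HasRadialSlope f₀ D c M) (hF : ∀ r ∈ Icc (0 : ℝ) 1, |sturm f₀ m Ω r - 1| ≤ 1 / 3) :
    c ^ 2 / (18 * hi) / 72 - 4 / 3 * (M / lo) * |kappa₂ f₀| / (2 * m + 2)
      ≤ ∫ r in (0 : ℝ)..1, transWeight f₀ D m Ω r * gDefect f₀ m r := by
  have hm : m ≠ 0 := by
    rintro rfl
    simpa using hgap.width_pos
  have hint : IntervalIntegrable (fun r : ℝ => c ^ 2 / (18 * hi) *
      (r ^ (2 * m + 3) * (m * (1 - r ^ 2) / (1 / m + 1 - r ^ 2)))) volume 0 1 :=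
    (continuousOn_const.mul (continuousOn_layer_kernel hm)).intervalIntegrable_of_Icc zero_le_one
  have hintκ : IntervalIntegrable (fun r : ℝ => 4 / 3 * (M / lo) * |kappa₂ f₀| * r ^ (2 * m + 1))
      volume 0 1 := Continuous.intervalIntegrable (by fun_prop) _ _
  have hlower : 0 ≤ c ^ 2 / (18 * hi) := div_nonneg (sq_nonneg c) (by linarith [hgap.upper_pos])
  calc c ^ 2 / (18 * hi) / 72 - 4 / 3 * (M / lo) * |kappa₂ f₀| / (2 * m + 2)
      ≤ c ^ 2 / (18 * hi) *
          (∫ r in (0 : ℝ)..1, r ^ (2 * m + 3) * (m * (1 - r ^ 2) / (1 / m + 1 - r ^ 2)))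
        - 4 / 3 * (M / lo) * |kappa₂ f₀| * ∫ r in (0 : ℝ)..1, r ^ (2 * m + 1) := by
        have hpow : ∫ r in (0 : ℝ)..1, r ^ (2 * m + 1) = 1 / (2 * m + 2) := by
          rw [integral_pow, one_pow, zero_pow (Nat.succ_ne_zero _), sub_zero]
          push_cast
          ring
        rw [hpow, mul_one_div, div_eq_mul_one_div (c ^ 2 / (18 * hi)) 72]
        exact sub_le_sub_right (mul_le_mul_of_nonneg_left (le_integral_layer_kernel hm) hlower) _
    _ = _ := by
        rw [← intervalIntegral.integral_const_mul, ← intervalIntegral.integral_const_mul,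
          ← intervalIntegral.integral_sub hint hintκ]
    _ ≤ _ := intervalIntegral.integral_mono_on zero_le_one (hint.sub hintκ)
        (ContinuousOn.intervalIntegrable_of_Icc zero_le_one
          ((h.continuousOn_transWeight hgap.gap_ne_zero m).mul (h.continuousOn_gDefect m)))
        fun r hr => hgap.le_transWeight_mul_gDefect h hF hm hr

end HasLayerGap

end BoundaryLayer

section NegativeProfile

open Filter Topology

variable {f₀ D : ℝ → ℝ} {a c p q r δ lo hi B M Ω : ℝ} {m : ℕ}

lemma HasRadialSlope.four_mul_transInt_eq (h : HasRadialSlope f₀ D c M) (hm : m ≠ 0)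
    (hgap : ∀ r ∈ Icc (0 : ℝ) 1, gap f₀ Ω r ≠ 0) (hF0 : ∀ r ∈ Icc (0 : ℝ) 1, sturm f₀ m Ω r ≠ 0)
    (hζ : zeta f₀ m Ω = 0) (hG : Gfun f₀ m Ω 1 ≠ 0) :
    4 * (m + 1) * transInt f₀ m Ω
      = 4 * (m + 1) * (∫ r in (0 : ℝ)..1,
          transWeight f₀ D m Ω r * (sourceResponse f₀ m Ω r / gap f₀ Ω r))
        + (∫ r in (0 : ℝ)..1, transWeight f₀ D m Ω r * gDefect f₀ m r) / Gfun f₀ m Ω 1 := by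
  have hweight := h.continuousOn_transWeight hgap m
  rw [h.transInt_eq hm hgap hF0 hζ hG, ← intervalIntegral.integral_const_mul,
    ← intervalIntegral.integral_const_mul, ← intervalIntegral.integral_div,
    ← intervalIntegral.integral_add]
  · refine intervalIntegral.integral_congr fun r _ => ?_
    simp only [transBracket]
    field_simp
  · exact ContinuousOn.intervalIntegrable_of_Icc zero_le_one (continuousOn_const.mul
      (hweight.mul ((h.continuousOn_sourceResponse hgap hF0).div (h.continuousOn_gap Ω) hgap)))
  · exact ContinuousOn.intervalIntegrable_of_Icc zero_le_one
      ((hweight.mul (h.continuousOn_gDefect m)).div_const _)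

namespace HasLayerGap

lemma transInt_le_sub_div (hgap : HasLayerGap f₀ Ω (1 / m) lo hi) (h : HasRadialSlope f₀ D c M)
    (hlog : M / lo * Real.log (1 + m) ≤ m + 1) (hB : ∀ r ∈ Icc (0 : ℝ) 1, |source f₀ Ω r| ≤ B)
    (hκ : 4 / 3 * (M / lo) * |kappa₂ f₀| / (2 * m + 2) ≤ c ^ 2 / (18 * hi) / 144)
    (hΩ : Ω < singularValue f₀ m) (hζ : zeta f₀ m Ω = 0) :
    4 * (m + 1) * transInt f₀ m Ω ≤ 8 / 3 * (M / lo) * (B / lo)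
      - c ^ 2 / (18 * hi) / 144 / (m * (singularValue f₀ m - Ω)) := by
  have hm0 : (0 : ℝ) < m := one_div_pos.1 hgap.width_pos
  have hm : m ≠ 0 := by exact_mod_cast hm0.ne'
  have hF := hgap.abs_sturm_sub_one_le (m := m) h (by rwa [one_div_one_div])
  have hF0 : ∀ r ∈ Icc (0 : ℝ) 1, sturm f₀ m Ω r ≠ 0 := fun r hr => by
    linarith [(abs_le.1 (hF r hr)).1]
  have hG : Gfun f₀ m Ω 1 = -(m * (singularValue f₀ m - Ω)) := by
    rw [Gfun_one hm]
    ring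
  have hdist : 0 < m * (singularValue f₀ m - Ω) := mul_pos hm0 (sub_pos.2 hΩ)
  have hresponse := hgap.abs_integral_transWeight_mul_response_le h hF hB
  have hdefect := hgap.le_integral_transWeight_mul_gDefect h hF
  rw [h.four_mul_transInt_eq hm hgap.gap_ne_zero hF0 hζ (hG.trans_ne (neg_neg_of_pos hdist).ne),
    hG, div_neg, ← sub_eq_add_neg]
  refine sub_le_sub ((mul_le_mul_of_nonneg_left (le_abs_self _) (by positivity)).trans hresponse)
    (div_le_div_of_nonneg_right ?_ hdist.le)
  linarith

lemma transInt_le_sub_rpow (hgap : HasLayerGap f₀ Ω (1 / m) lo hi) (h : HasRadialSlope f₀ D c M)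
    (hlog : M / lo * Real.log (1 + m) ≤ m + 1) (hB : ∀ r ∈ Icc (0 : ℝ) 1, |source f₀ Ω r| ≤ B)
    (hκ : 4 / 3 * (M / lo) * |kappa₂ f₀| / (2 * m + 2) ≤ c ^ 2 / (18 * hi) / 144)
    (hΩ : Ω ∈ Ioo (singularValue f₀ m - (m : ℝ) ^ (-a)) (singularValue f₀ m))
    (hζ : zeta f₀ m Ω = 0) :
    4 * (m + 1) * transInt f₀ m Ω
      ≤ 8 / 3 * (M / lo) * (B / lo) - c ^ 2 / (18 * hi) / 144 * (m : ℝ) ^ (a - 1) := by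
  have hm0 : (0 : ℝ) < m := one_div_pos.1 hgap.width_pos
  have hdist : m * (singularValue f₀ m - Ω) ≤ (m : ℝ) ^ (1 - a) := by
    rw [sub_eq_add_neg 1 a, Real.rpow_add hm0, Real.rpow_one]
    exact mul_le_mul_of_nonneg_left (by linarith [hΩ.1]) hm0.le
  have hdist0 : 0 < m * (singularValue f₀ m - Ω) := mul_pos hm0 (sub_pos.2 hΩ.2)
  have hhi := hgap.upper_pos
  refine (hgap.transInt_le_sub_div h hlog hB hκ hΩ.2 hζ).trans (sub_le_sub_left ?_ _)
  calc _ = c ^ 2 / (18 * hi) / 144 / (m : ℝ) ^ (1 - a) := by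
        rw [← neg_sub 1 a, Real.rpow_neg hm0.le, ← div_eq_mul_inv]
    _ ≤ _ := div_le_div_of_nonneg_left (by positivity) hdist0 hdist

end HasLayerGap

namespace HasRadialSlope

lemma hasLayerGap (h : HasRadialSlope f₀ D c M) (hδ : 0 < δ) (hp : 0 < p)
    (hΩ : Ω - kappa₂ f₀ ∈ Icc (p * δ) (q * δ)) :
    HasLayerGap f₀ Ω δ (min p (c / 8)) (max q (M / 8)) where
  width_pos := hδ
  lower_pos := lt_min hp (by linarith [h.pos])
  gap_mem r hr := by
    have hsq : 0 ≤ 1 - r ^ 2 := sub_nonneg.2 (pow_le_one₀ hr.1 hr.2)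
    have hgap : gap f₀ Ω r
        = (Ω - kappa₂ f₀) + (radialAvg 1 f₀ 1 - radialAvg 1 f₀ r) := by
      rw [gap, kappa₂_eq_radialAvg]
      ring
    rw [hgap, add_sub_assoc, mul_add, mul_add]
    exact ⟨add_le_add ((mul_le_mul_of_nonneg_right (min_le_left _ _) hδ.le).trans hΩ.1)
        ((mul_le_mul_of_nonneg_right (min_le_right _ _) hsq).trans (h.le_radialAvg_increment hr)),
      add_le_add (hΩ.2.trans (mul_le_mul_of_nonneg_right (le_max_left _ _) hδ.le))
        ((h.radialAvg_increment_le hr).trans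
          (mul_le_mul_of_nonneg_right (le_max_right _ _) hsq))⟩

lemma singularValue_sub_kappa₂_mem (h : HasRadialSlope f₀ D c M) (hm : m ≠ 0) :
    singularValue f₀ m - kappa₂ f₀ ∈ Icc (-f₀ 1 / 2 * (1 / m)) (-f₀ 0 / 2 * (1 / m)) := by
  have havg := h.radialAvg_mem (2 * m + 1) ⟨zero_le_one, le_rfl⟩
  have hfactor : 0 ≤ ((m : ℝ) + 1) / m := by positivity
  have hlo := mul_le_mul_of_nonneg_left havg.1 hfactor
  have hhi := mul_le_mul_of_nonneg_left havg.2 hfactor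
  have hcancel : ∀ y : ℝ, ((m : ℝ) + 1) / m * (y / ((2 * m + 1 : ℕ) + 1)) = y / 2 * (1 / m) :=
    fun y => by
      push_cast
      field_simp
      ring
  rw [hcancel] at hlo hhi
  rw [singularValue_eq_radialAvg]
  constructor <;> linarith

lemma sub_kappa₂_mem (h : HasRadialSlope f₀ D c M) (hm : m ≠ 0)
    (hpow : (m : ℝ) ^ (1 - a) ≤ -f₀ 1 / 4)
    (hΩ : Ω ∈ Ioo (singularValue f₀ m - (m : ℝ) ^ (-a)) (singularValue f₀ m)) :
    Ω - kappa₂ f₀ ∈ Icc (-f₀ 1 / 4 * (1 / m)) (-f₀ 0 / 2 * (1 / m)) := by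
  have hm0 : (0 : ℝ) < m := by exact_mod_cast Nat.pos_of_ne_zero hm
  have hsingular := h.singularValue_sub_kappa₂_mem hm
  have hdist : (m : ℝ) ^ (-a) ≤ -f₀ 1 / 4 * (1 / m) := by
    rw [show -a = (1 - a) - 1 by ring, Real.rpow_sub_one hm0.ne', div_eq_mul_one_div]
    exact mul_le_mul_of_nonneg_right hpow (by positivity)
  constructor <;> linarith [hΩ.1, hΩ.2, hsingular.1, hsingular.2]

lemma abs_source_le_of_sub_kappa₂_mem (h : HasRadialSlope f₀ D c M) (hneg : f₀ 1 < 0) (hm : m ≠ 0)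
    (hΩ : Ω - kappa₂ f₀ ∈ Icc (-f₀ 1 / 4 * (1 / m)) (-f₀ 0 / 2 * (1 / m)))
    (hr : r ∈ Icc (0 : ℝ) 1) : |source f₀ Ω r| ≤ |kappa₂ f₀| - f₀ 0 := by
  have hm1 : (1 : ℝ) ≤ m := by exact_mod_cast Nat.one_le_iff_ne_zero.2 hm
  have hlo := h.monotoneOn ⟨le_rfl, zero_le_one⟩ hr hr.1
  have hhi := h.monotoneOn hr ⟨zero_le_one, le_rfl⟩ hr.2
  have hΩ0 : 0 ≤ Ω - kappa₂ f₀ := le_trans (mul_nonneg (by linarith) (by positivity)) hΩ.1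
  have hΩ1 : Ω - kappa₂ f₀ ≤ -f₀ 0 / 2 := hΩ.2.trans (mul_le_of_le_one_right
    (by linarith [h.apply_zero_lt_apply_one]) ((div_le_one (by positivity)).2 hm1))
  rw [source, abs_le]
  constructor <;> linarith [neg_abs_le (kappa₂ f₀), le_abs_self (kappa₂ f₀)]

end HasRadialSlope

lemma eventually_mul_log_one_add_natCast_le (A : ℝ) :
    ∀ᶠ m : ℕ in atTop, A * Real.log (1 + m) ≤ m + 1 := by
  have hcast : Tendsto (fun m : ℕ => (1 : ℝ) + m) atTop atTop :=
    tendsto_atTop_add_const_left _ _ tendsto_natCast_atTop_atTop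
  filter_upwards [hcast.eventually
    ((Real.isLittleO_log_id_atTop.const_mul_left A).bound zero_lt_one)] with m hm
  rw [one_mul, id, Real.norm_of_nonneg (by positivity : (0 : ℝ) ≤ 1 + m), add_comm (1 : ℝ)] at hm
  rw [add_comm (1 : ℝ)]
  exact (le_abs_self _).trans hm

theorem HasRadialSlope.eventually_transInt_le (h : HasRadialSlope f₀ D c M) (hneg : f₀ 1 < 0)
    (ha : 1 < a) (K : ℝ) : ∀ᶠ m : ℕ in atTop,
      ∀ Ω ∈ Ioo (singularValue f₀ m - (m : ℝ) ^ (-a)) (singularValue f₀ m),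
        zeta f₀ m Ω = 0 → 4 * ((m : ℝ) + 1) * transInt f₀ m Ω ≤ K := by
  set lo := min (-f₀ 1 / 4) (c / 8)
  set hi := max (-f₀ 0 / 2) (M / 8)
  have hhi0 : 0 < hi := lt_max_of_lt_right (by linarith [h.upper_pos])
  have hα : 0 < c ^ 2 / (18 * hi) / 144 := by
    have := h.pos
    positivity
  have hgrowth : Tendsto (fun m : ℕ => c ^ 2 / (18 * hi) / 144 * (m : ℝ) ^ (a - 1)) atTop atTop :=
    ((tendsto_rpow_atTop (sub_pos.2 ha)).comp tendsto_natCast_atTop_atTop).const_mul_atTop hα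
  have hdecay : Tendsto (fun m : ℕ => (m : ℝ) ^ (1 - a)) atTop (𝓝 0) := by
    rw [← neg_sub a 1]
    exact (tendsto_rpow_neg_atTop (sub_pos.2 ha)).comp tendsto_natCast_atTop_atTop
  have hκ : Tendsto (fun m : ℕ => 4 / 3 * (M / lo) * |kappa₂ f₀| / (2 * (m : ℝ) + 2)) atTop (𝓝 0) :=
    tendsto_const_nhds.div_atTop (tendsto_atTop_add_const_right _ _
      (tendsto_natCast_atTop_atTop.const_mul_atTop zero_lt_two))
  filter_upwards [eventually_ne_atTop 0, hdecay.eventually_le_const (by linarith : 0 < -f₀ 1 / 4),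
    eventually_mul_log_one_add_natCast_le (M / lo), hκ.eventually_le_const hα,
    hgrowth.eventually_ge_atTop (8 / 3 * (M / lo) * ((|kappa₂ f₀| - f₀ 0) / lo) - K)]
    with m hm hpow hlog hκm hlarge Ω hΩ hζ
  have hmem := h.sub_kappa₂_mem hm hpow hΩ
  have hgap : HasLayerGap f₀ Ω (1 / m) lo hi := h.hasLayerGap
    (one_div_pos.2 (by exact_mod_cast Nat.pos_of_ne_zero hm)) (by linarith) hmem
  linarith [hgap.transInt_le_sub_rpow h hlog
    (fun r hr => h.abs_source_le_of_sub_kappa₂_mem hneg hm hmem hr) hκm hΩ hζ]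

end NegativeProfile

open Filter in
theorem proposition5p3_general {f₀ g : ℝ → ℝ} (hg : ContDiffOn ℝ 1 g (Icc 0 1))
    (hf₀ : ∀ r ∈ Icc (0 : ℝ) 1, f₀ r = g (r ^ 2)) (hmono : MonotoneProfile f₀) :
    (0 < f₀ 0 → ∀ m : ℕ, 1 ≤ m → (m : ℝ) ≤ 1 / 10 * (f₀ 0 / (f₀ 1 - f₀ 0)) →
      ∀ Ω ∈ Ioo (singularValue f₀ m) ((m : ℝ) * kappa₂ f₀ / (m + 1)),
        zeta f₀ m Ω = 0 → transInt f₀ m Ω ≠ 0) ∧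
    (f₀ 1 < 0 → ∀ a : ℝ, 1 < a →
      (∃ m₀ : ℕ, 1 ≤ m₀ ∧ ∀ m : ℕ, m₀ ≤ m →
        ∀ Ω ∈ Ioo (singularValue f₀ m - (m : ℝ) ^ (-a)) (singularValue f₀ m),
          zeta f₀ m Ω = 0 → transInt f₀ m Ω ≠ 0) ∧
      ∀ K : ℝ, ∃ m₀ : ℕ, 1 ≤ m₀ ∧ ∀ m : ℕ, m₀ ≤ m →
        ∀ Ω ∈ Ioo (singularValue f₀ m - (m : ℝ) ^ (-a)) (singularValue f₀ m),
          zeta f₀ m Ω = 0 → K ≤ 4 * ((m : ℝ) + 1) * |transInt f₀ m Ω|) := by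
  obtain ⟨D, c, M, h⟩ := exists_hasRadialSlope hg hf₀ hmono
  refine ⟨fun hpos m hm hflat Ω hΩ hζ => ?_, fun hneg a ha => ?_⟩
  · have hflat' : 10 * m * (f₀ 1 - f₀ 0) ≤ f₀ 0 :=
      (le_div_iff₀ (sub_pos.2 h.apply_zero_lt_apply_one)).1 (by linarith)
    exact (h.transInt_pos hpos (Nat.one_le_iff_ne_zero.1 hm) hflat' hΩ hζ).ne'
  · have hlarge : ∀ K : ℝ, ∃ m₀ : ℕ, 1 ≤ m₀ ∧ ∀ m : ℕ, m₀ ≤ m →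
        ∀ Ω ∈ Ioo (singularValue f₀ m - (m : ℝ) ^ (-a)) (singularValue f₀ m),
          zeta f₀ m Ω = 0 → K ≤ 4 * ((m : ℝ) + 1) * |transInt f₀ m Ω| := fun K => by
      obtain ⟨m₀, hm₀⟩ := eventually_atTop.1 (h.eventually_transInt_le hneg ha (-K))
      refine ⟨max 1 m₀, le_max_left _ _, fun m hm Ω hΩ hζ => ?_⟩
      have hbound := hm₀ m (le_of_max_le_right hm) Ω hΩ hζ
      have habs := mul_le_mul_of_nonneg_left (neg_abs_le (transInt f₀ m Ω))
        (by positivity : 0 ≤ 4 * ((m : ℝ) + 1))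
      linarith
    obtain ⟨m₀, hm₀, hone⟩ := hlarge 1
    refine ⟨⟨m₀, hm₀, fun m hm Ω hΩ hζ h0 => ?_⟩, hlarge⟩
    have := hone m hm Ω hΩ hζ
    rw [h0, abs_zero, mul_zero] at this
    linarith

end

end RadialEuler

theorem proposition5p3 (β : ℝ) (hβ : β ∈ Set.Ioo (0 : ℝ) 1) (f₀ : ℝ → ℝ)
    (hsmooth : RadialEuler.SmoothProfile β f₀) (hmono : RadialEuler.MonotoneProfile f₀) :
    ((∀ r ∈ Set.Icc (0 : ℝ) 1, 0 < f₀ r) →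
      ∀ m : ℕ, 3 ≤ m → (m : ℝ) ≤ 1 / 10 * (f₀ 0 / (f₀ 1 - f₀ 0)) →
        ∀ Ω ∈ Set.Ioo (RadialEuler.singularValue f₀ m)
            ((m : ℝ) * RadialEuler.kappa₂ f₀ / (m + 1)),
          RadialEuler.zeta f₀ m Ω = 0 → RadialEuler.transInt f₀ m Ω ≠ 0) ∧
    ((∀ r ∈ Set.Icc (0 : ℝ) 1, f₀ r < 0) →
      ∀ a ∈ Set.Ioo (1 : ℝ) 2,
        (∃ m₀ : ℕ, 1 ≤ m₀ ∧ ∀ m : ℕ, m₀ ≤ m →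
          ∀ Ω ∈ Set.Ioo (RadialEuler.singularValue f₀ m - (m : ℝ) ^ (-a))
              (RadialEuler.singularValue f₀ m),
            RadialEuler.zeta f₀ m Ω = 0 → RadialEuler.transInt f₀ m Ω ≠ 0) ∧
        (∀ K : ℝ, ∃ m₀ : ℕ, 1 ≤ m₀ ∧ ∀ m : ℕ, m₀ ≤ m →
          ∀ Ω ∈ Set.Ioo (RadialEuler.singularValue f₀ m - (m : ℝ) ^ (-a))
              (RadialEuler.singularValue f₀ m),
            RadialEuler.zeta f₀ m Ω = 0 →
              K ≤ 4 * ((m : ℝ) + 1) * |RadialEuler.transInt f₀ m Ω|)) := by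
  obtain ⟨g, hf₀, hg, -⟩ := hsmooth
  obtain ⟨hpositive, hnegative⟩ :=
    RadialEuler.proposition5p3_general (hg.of_le one_le_two) hf₀ hmono
  exact ⟨fun hpos m hm => hpositive (hpos 0 ⟨le_rfl, zero_le_one⟩) m (by lia),
    fun hneg a ha => hnegative (hneg 1 ⟨zero_le_one, le_rfl⟩) a ha.1⟩
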